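/- Let $\mathbf{C}$ be a (fully weak) symmetric monoidal 2-category with unit object $I$, equipped with a reversal operation $\dagger$ on 2-cells: an involution that is the identity on objects and 1-cells, reverses vertical composition, and preserves all the structure (whiskering, tensor product, and structural isomorphisms, which are all unitary). Composites of 1-cells are written in diagrammatic order, so $F;G$ means first $F$, then $G$; the composite $\beta\cdot\alpha$ of 2-cells means first $\alpha$, then $\beta$. Structural isomorphisms of the 2-category are suppressed. The *scalars* of $\mathbf{C}$ are the 1-cells $I\to I$; they form a symmetric monoidal category under composition of 1-cells, whose symmetry $\sigma_{F,G}\colon F;G\Rightarrow G;F$ is induced by the monoidal structure of $\mathbf{C}$. A *witness* for an object $A$ consists of 1-cells $R\colon A\to I$ and $L\colon I\to A$ and 2-cells $\eta\colon \mathrm{id}_I\Rightarrow L;R$ and $\varepsilon\colon R;L\Rightarrow \mathrm{id}_A$ such that: - $(\varepsilon; R)\cdot(R;\eta)=\mathrm{id}_R$ and $(L;\varepsilon)\cdot(\eta;L)=\mathrm{id}_L$, and the reversed equations $(R;\eta^\dagger)\cdot(\varepsilon^\dagger;R)=\mathrm{id}_R$ and $(\eta^\dagger;L)\cdot(L;\varepsilon^\dagger)=\mathrm{id}_L$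 hold as well (so that $L$ and $R$ are ambidextrous duals); - $\varepsilon\cdot\varepsilon^\dagger=\mathrm{id}_{\mathrm{id}_A}$; - $m\cdot\sigma_{S,S}=m$, where $S=L;R$ and $m=L;\varepsilon;R\colon S;S\Rightarrow S$. A *projective measurement* of a scalar $T\colon I\to I$ with respect to this witness consists of a 1-cell $T_A\colon I\to A$ and a unitary 2-cell $\mu\colon T\Rightarrow T_A;R$, i.e. $\mu^\dagger\cdot\mu=\mathrm{id}$ and $\mu\cdot\mu^\dagger=\mathrm{id}$. **Theorem.** For every witness for $A$ and every projective measurement $(T_A,\mu)$ of $T$ with respect to it: 1. $S=L;R$, with multiplication $m$ and unit $\eta$, is a commutative $\dagger$-Frobenius algebra in the category of scalars: $m$ is associative and commutative with two-sided unit $\eta$, and $(S;m)\cdot(m^\dagger;S)=m^\dagger\cdot m=(m;S)\cdot(S;m^\dagger)$. 2. The 2-cell $$a=\mu^\dagger\cdot(T_A;\varepsilon;R)\cdot(\mu;S)\colon\ T;S\Rightarrow T$$ makes $T$ a (right) module for this algebra: $a\cdot(a;S)=a\cdot(T;m)$ and $a\cdot(T;\eta)=\mathrm{id}_T$. -/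

import Mathlib

universe w v u

namespace HQ

open CategoryTheory Bicategory

section Pseudofunctors

universe w₁ w₂ w₃ v₁ v₂ v₃ u₁ u₂ u₃

variable {B : Type u₁} [Bicategory.{w₁, v₁} B] {C : Type u₂} [Bicategory.{w₂, v₂} C]
  {D : Type u₃} [Bicategory.{w₃, v₃} D]

/-- The first projection of a product of bicategories. -/
def fstP : (B × C) ⥤ᵖ B where
  obj X := X.1
  map f := f.1
  map₂ η := η.1
  mapId _ := Iso.refl _
  mapComp _ _ := Iso.refl _

/-- The second projection of a product of bicategories. -/
def sndP : (B × C) ⥤ᵖ C where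
  obj X := X.2
  map f := f.2
  map₂ η := η.2
  mapId _ := Iso.refl _
  mapComp _ _ := Iso.refl _

/-- The pseudofunctor into a product of bicategories with given components. -/
def pairP (F : D ⥤ᵖ B) (G : D ⥤ᵖ C) : D ⥤ᵖ (B × C) where
  obj X := (F.obj X, G.obj X)
  map f := (F.map f, G.map f)
  map₂ η := (F.map₂ η, G.map₂ η)
  map₂_id _ := Prod.ext (F.map₂_id _) (G.map₂_id _)
  map₂_comp _ _ := Prod.ext (F.map₂_comp _ _) (G.map₂_comp _ _)
  mapId X := Iso.prod (F.mapId X) (G.mapId X)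
  mapComp f g := Iso.prod (F.mapComp f g) (G.mapComp f g)
  map₂_whisker_left _ _ _ _ := Prod.ext (F.map₂_whisker_left _ _) (G.map₂_whisker_left _ _)
  map₂_whisker_right _ _ := Prod.ext (F.map₂_whisker_right _ _) (G.map₂_whisker_right _ _)
  map₂_associator _ _ _ := Prod.ext (F.map₂_associator _ _ _) (G.map₂_associator _ _ _)
  map₂_left_unitor _ := Prod.ext (F.map₂_left_unitor _) (G.map₂_left_unitor _)
  map₂_right_unitor _ := Prod.ext (F.map₂_right_unitor _) (G.map₂_right_unitor _)

/-- The pseudofunctor which is constant at `b`, sending all 2-cells to identities. -/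
def constP (b : B) : D ⥤ᵖ B where
  obj _ := b
  map _ := 𝟙 b
  map₂ _ := 𝟙 _
  mapId _ := Iso.refl _
  mapComp _ _ := (λ_ (𝟙 b)).symm

/-- A pseudonatural equivalence: a pseudonatural transformation each of whose components is
equipped with a chosen adjoint inverse. -/
structure PseudonatEquiv (F G : B ⥤ᵖ C) extends Pseudofunctor.StrongTrans F G where
  inv (X : B) : G.obj X ⟶ F.obj X
  unit (X : B) : 𝟙 (F.obj X) ≅ app X ≫ inv X
  counit (X : B) : inv X ≫ app X ≅ 𝟙 (G.obj X)
  left_triangle (X : B) :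
    leftZigzagIso (unit X) (counit X) = λ_ (app X) ≪≫ (ρ_ (app X)).symm

end Pseudofunctors

section Tensor

/-- A bicategory with a tensor product (a pseudofunctor of two variables) and a unit object. -/
class TensorBicategory (B : Type u) [Bicategory.{w, v} B] where
  tensor : (B × B) ⥤ᵖ B
  I : B


variable {B : Type u} [Bicategory.{w, v} B] [TensorBicategory B]

/-- The tensor product of objects. -/
def tObj (X Y : B) : B := (TensorBicategory.tensor (B := B)).obj (X, Y)

local infixr:85 " ⊠ " => tObj

/-- The tensor product of 1-cells. -/
def tHom {X X' Y Y' : B} (f : X ⟶ X') (g : Y ⟶ Y') : X ⊠ Y ⟶ X' ⊠ Y' :=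
  (TensorBicategory.tensor (B := B)).map (X := (X, Y)) (Y := (X', Y')) (f, g)

local infixr:85 " ⊠₁ " => tHom

/-- The tensor product of invertible 2-cells. -/
def tIso {X X' Y Y' : B} {f f' : X ⟶ X'} {g g' : Y ⟶ Y'} (σ : f ≅ f') (τ : g ≅ g') :
    f ⊠₁ g ≅ f' ⊠₁ g' :=
  (TensorBicategory.tensor (B := B)).map₂Iso (a := (X, Y)) (b := (X', Y'))
    (f := (f, g)) (g := (f', g')) (Iso.prod σ τ)

/-- Compatibility of the tensor product with composition of 1-cells. -/
def tComp {X X' X'' Y Y' Y'' : B} (f : X ⟶ X') (g : Y ⟶ Y') (f' : X' ⟶ X'') (g' : Y' ⟶ Y'') :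
    f ⊠₁ g ≫ f' ⊠₁ g' ≅ (f ≫ f') ⊠₁ (g ≫ g') :=
  ((TensorBicategory.tensor (B := B)).mapComp (a := (X, Y)) (b := (X', Y')) (c := (X'', Y''))
    (f, g) (f', g')).symm

/-- Compatibility of the tensor product with identity 1-cells. -/
def tId (X Y : B) : 𝟙 X ⊠₁ 𝟙 Y ≅ 𝟙 (X ⊠ Y) :=
  (TensorBicategory.tensor (B := B)).mapId (X, Y)

/-- Tensoring a 1-cell on the left with an object. -/
abbrev tL (X : B) {Y Y' : B} (g : Y ⟶ Y') : X ⊠ Y ⟶ X ⊠ Y' := 𝟙 X ⊠₁ g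

/-- Tensoring a 1-cell on the right with an object. -/
abbrev tR {X X' : B} (f : X ⟶ X') (Y : B) : X ⊠ Y ⟶ X' ⊠ Y := f ⊠₁ 𝟙 Y

local infixr:85 " ⊠ˡ " => tL
local infixl:85 " ⊠ʳ " => tR

abbrev tLIso (X : B) {Y Y' : B} {f g : Y ⟶ Y'} (σ : f ≅ g) : X ⊠ˡ f ≅ X ⊠ˡ g :=
  tIso (Iso.refl _) σ

abbrev tRIso {X X' : B} {f g : X ⟶ X'} (σ : f ≅ g) (Y : B) : f ⊠ʳ Y ≅ g ⊠ʳ Y :=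
  tIso σ (Iso.refl _)

def tLComp (X : B) {Y Y' Y'' : B} (f : Y ⟶ Y') (g : Y' ⟶ Y'') :
    X ⊠ˡ f ≫ X ⊠ˡ g ≅ X ⊠ˡ (f ≫ g) :=
  tComp _ _ _ _ ≪≫ tIso (λ_ _) (Iso.refl _)

def tRComp {X X' X'' : B} (f : X ⟶ X') (g : X' ⟶ X'') (Y : B) :
    f ⊠ʳ Y ≫ g ⊠ʳ Y ≅ (f ≫ g) ⊠ʳ Y :=
  tComp _ _ _ _ ≪≫ tIso (Iso.refl _) (λ_ _)

def tLComp₃ (X : B) {Y Y' Y'' Y''' : B} (f : Y ⟶ Y') (g : Y' ⟶ Y'') (h : Y'' ⟶ Y''') :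
    X ⊠ˡ f ≫ X ⊠ˡ g ≫ X ⊠ˡ h ≅ X ⊠ˡ (f ≫ g ≫ h) :=
  whiskerLeftIso _ (tLComp X g h) ≪≫ tLComp X f (g ≫ h)

def tRComp₃ {X X' X'' X''' : B} (f : X ⟶ X') (g : X' ⟶ X'') (h : X'' ⟶ X''') (Y : B) :
    f ⊠ʳ Y ≫ g ⊠ʳ Y ≫ h ⊠ʳ Y ≅ (f ≫ g ≫ h) ⊠ʳ Y :=
  whiskerLeftIso _ (tRComp g h Y) ≪≫ tRComp f (g ≫ h) Y

/-- `f ⊠ g`, decomposed with the first factor acting first. -/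
def tSplit {X X' Y Y' : B} (f : X ⟶ X') (g : Y ⟶ Y') : f ⊠₁ g ≅ f ⊠ʳ Y ≫ X' ⊠ˡ g :=
  tIso (ρ_ f).symm (λ_ g).symm ≪≫ (tComp _ _ _ _).symm

/-- `f ⊠ g`, decomposed with the second factor acting first. -/
def tSplit' {X X' Y Y' : B} (f : X ⟶ X') (g : Y ⟶ Y') : f ⊠₁ g ≅ X ⊠ˡ g ≫ f ⊠ʳ Y' :=
  tIso (λ_ f).symm (ρ_ g).symm ≪≫ (tComp _ _ _ _).symm

/-- The interchanger of two 1-cells acting on different tensor factors. -/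
def tSwap {X X' Y Y' : B} (f : X ⟶ X') (g : Y ⟶ Y') :
    f ⊠ʳ Y ≫ X' ⊠ˡ g ≅ X ⊠ˡ g ≫ f ⊠ʳ Y' :=
  (tSplit f g).symm ≪≫ tSplit' f g

/-! Squares filled with an invertible 2-cell, as they occur in pseudonaturality. -/

/-- Vertical pasting of squares. -/
def sqComp {X X' Y Y' Z Z' : B} {f : X ⟶ X'} {u : X ⟶ Y} {u' : X' ⟶ Y'} {g : Y ⟶ Y'}
    {s : Y ⟶ Z} {s' : Y' ⟶ Z'} {h : Z ⟶ Z'} (σ : f ≫ u' ≅ u ≫ g) (τ : g ≫ s' ≅ s ≫ h) :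
    f ≫ (u' ≫ s') ≅ (u ≫ s) ≫ h :=
  (α_ _ _ _).symm ≪≫ whiskerRightIso σ s' ≪≫ α_ _ _ _ ≪≫ whiskerLeftIso u τ ≪≫
    (α_ _ _ _).symm

/-- The identity square on a 1-cell. -/
def sqId {X X' : B} (f : X ⟶ X') : f ≫ 𝟙 X' ≅ 𝟙 X ≫ f := ρ_ f ≪≫ (λ_ f).symm

/-- The tensor product of squares. -/
def sqTensor {X X' Y Y' : B} {f : X ⟶ X'} {u : X ⟶ Y} {u' : X' ⟶ Y'} {g : Y ⟶ Y'}
    {P P' Q Q' : B} {h : P ⟶ P'} {s : P ⟶ Q} {s' : P' ⟶ Q'} {k : Q ⟶ Q'}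
    (σ : f ≫ u' ≅ u ≫ g) (τ : h ≫ s' ≅ s ≫ k) :
    f ⊠₁ h ≫ u' ⊠₁ s' ≅ u ⊠₁ s ≫ g ⊠₁ k :=
  tComp _ _ _ _ ≪≫ tIso σ τ ≪≫ (tComp _ _ _ _).symm

/-- Given a square whose sides `u`, `u'` have inverses `s`, `s'`, the square with the inverse
sides. -/
def sqInv {X X' Y Y' : B} {f : X ⟶ X'} {u : X ⟶ Y} {u' : X' ⟶ Y'} {g : Y ⟶ Y'}
    {s : Y ⟶ X} {s' : Y' ⟶ X'} (e : s ≫ u ≅ 𝟙 Y) (n : 𝟙 X' ≅ u' ≫ s')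
    (σ : f ≫ u' ≅ u ≫ g) : g ≫ s' ≅ s ≫ f :=
  Iso.refl _ ≪⊗≫ e.symm ▷ᵢ (g ≫ s') ≪⊗≫ s ◁ᵢ σ.symm ▷ᵢ s' ≪⊗≫ (s ≫ f) ◁ᵢ n.symm ≪⊗≫
    Iso.refl _

/-- The condition that an invertible 2-cell `m`, with `m'` its value at another object, is
compatible with two squares; this is the defining condition of a modification. -/
def SqCompat {X X' Y Y' : B} {f : X ⟶ X'} {g : Y ⟶ Y'} {u s : X ⟶ Y} {u' s' : X' ⟶ Y'}
    (σ : f ≫ u' ≅ u ≫ g) (τ : f ≫ s' ≅ s ≫ g) (m : u ≅ s) (m' : u' ≅ s') : Prop :=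
  σ ≪≫ whiskerRightIso m g = whiskerLeftIso f m' ≪≫ τ

end Tensor

section Monoidal

open TensorBicategory

local infixr:85 " ⊠ " => tObj
local infixr:85 " ⊠₁ " => tHom
local infixr:85 " ⊠ˡ " => tL
local infixl:85 " ⊠ʳ " => tR

/-- The pseudofunctor `((X, Y), Z) ↦ (X ⊠ Y) ⊠ Z`. -/
def tensorLeft₃ (B : Type u) [Bicategory.{w, v} B] [TensorBicategory B] :
    ((B × B) × B) ⥤ᵖ B :=
  (pairP (fstP.comp tensor) sndP).comp tensor

/-- The pseudofunctor `((X, Y), Z) ↦ X ⊠ (Y ⊠ Z)`. -/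
def tensorRight₃ (B : Type u) [Bicategory.{w, v} B] [TensorBicategory B] :
    ((B × B) × B) ⥤ᵖ B :=
  (pairP (fstP.comp fstP) ((pairP (fstP.comp sndP) sndP).comp tensor)).comp tensor

/-- The pseudofunctor `X ↦ I ⊠ X`. -/
def unitTensor (B : Type u) [Bicategory.{w, v} B] [TensorBicategory B] : B ⥤ᵖ B :=
  (pairP (constP I) (Pseudofunctor.id B)).comp tensor

/-- The pseudofunctor `X ↦ X ⊠ I`. -/
def tensorUnit (B : Type u) [Bicategory.{w, v} B] [TensorBicategory B] : B ⥤ᵖ B :=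
  (pairP (Pseudofunctor.id B) (constP I)).comp tensor

/-- The pseudofunctor `(X, Y) ↦ Y ⊠ X`. -/
def tensorOp (B : Type u) [Bicategory.{w, v} B] [TensorBicategory B] : (B × B) ⥤ᵖ B :=
  (pairP sndP fstP).comp tensor

/-- Associators and unitors, as pseudonatural equivalences. -/
class AssocUnitBicategory (B : Type u) [Bicategory.{w, v} B] extends TensorBicategory B where
  assocT : PseudonatEquiv (tensorLeft₃ B) (tensorRight₃ B)
  leftT : PseudonatEquiv (unitTensor B) (Pseudofunctor.id B)
  rightT : PseudonatEquiv (tensorUnit B) (Pseudofunctor.id B)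

section

variable {B : Type u} [Bicategory.{w, v} B] [AssocUnitBicategory B]

open AssocUnitBicategory

/-- The associator 1-cell. -/
def as (X Y Z : B) : (X ⊠ Y) ⊠ Z ⟶ X ⊠ (Y ⊠ Z) := assocT.app ((X, Y), Z)

/-- The adjoint inverse of the associator 1-cell. -/
def as' (X Y Z : B) : X ⊠ (Y ⊠ Z) ⟶ (X ⊠ Y) ⊠ Z := assocT.inv ((X, Y), Z)

def asUnit (X Y Z : B) : 𝟙 ((X ⊠ Y) ⊠ Z) ≅ as X Y Z ≫ as' X Y Z := assocT.unit ((X, Y), Z)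

def asCounit (X Y Z : B) : as' X Y Z ≫ as X Y Z ≅ 𝟙 (X ⊠ (Y ⊠ Z)) :=
  assocT.counit ((X, Y), Z)

def asNat {X X' Y Y' Z Z' : B} (f : X ⟶ X') (g : Y ⟶ Y') (h : Z ⟶ Z') :
    (f ⊠₁ g) ⊠₁ h ≫ as X' Y' Z' ≅ as X Y Z ≫ f ⊠₁ (g ⊠₁ h) :=
  assocT.naturality (a := ((X, Y), Z)) (b := ((X', Y'), Z')) ((f, g), h)

def asNat' {X X' Y Y' Z Z' : B} (f : X ⟶ X') (g : Y ⟶ Y') (h : Z ⟶ Z') :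
    f ⊠₁ (g ⊠₁ h) ≫ as' X' Y' Z' ≅ as' X Y Z ≫ (f ⊠₁ g) ⊠₁ h :=
  sqInv (asCounit X Y Z) (asUnit X' Y' Z') (asNat f g h)

/-- Naturality of the associator in its first argument. -/
def asNat₁ {X X' : B} (f : X ⟶ X') (Y Z : B) :
    (f ⊠ʳ Y) ⊠ʳ Z ≫ as X' Y Z ≅ as X Y Z ≫ f ⊠ʳ (Y ⊠ Z) :=
  asNat f (𝟙 Y) (𝟙 Z) ≪≫ whiskerLeftIso _ (tIso (Iso.refl f) (tId Y Z))

/-- Naturality of the associator in its second argument. -/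
def asNat₂ (X : B) {Y Y' : B} (g : Y ⟶ Y') (Z : B) :
    (X ⊠ˡ g) ⊠ʳ Z ≫ as X Y' Z ≅ as X Y Z ≫ X ⊠ˡ (g ⊠ʳ Z) :=
  asNat (𝟙 X) g (𝟙 Z)

/-- Naturality of the associator in its third argument. -/
def asNat₃ (X Y : B) {Z Z' : B} (h : Z ⟶ Z') :
    (X ⊠ Y) ⊠ˡ h ≫ as X Y Z' ≅ as X Y Z ≫ X ⊠ˡ (Y ⊠ˡ h) :=
  whiskerRightIso (tIso (tId X Y).symm (Iso.refl h)) _ ≪≫ asNat (𝟙 X) (𝟙 Y) h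

/-- Naturality of the inverse associator in its first argument. -/
def asNat₁' {X X' : B} (f : X ⟶ X') (Y Z : B) :
    f ⊠ʳ (Y ⊠ Z) ≫ as' X' Y Z ≅ as' X Y Z ≫ (f ⊠ʳ Y) ⊠ʳ Z :=
  whiskerRightIso (tIso (Iso.refl f) (tId Y Z).symm) _ ≪≫ asNat' f (𝟙 Y) (𝟙 Z)

/-- Naturality of the inverse associator in its third argument. -/
def asNat₃' (X Y : B) {Z Z' : B} (h : Z ⟶ Z') :
    X ⊠ˡ (Y ⊠ˡ h) ≫ as' X Y Z' ≅ as' X Y Z ≫ (X ⊠ Y) ⊠ˡ h :=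
  asNat' (𝟙 X) (𝟙 Y) h ≪≫ whiskerLeftIso _ (tIso (tId X Y) (Iso.refl h))

/-- The left unitor 1-cell. -/
def lu (X : B) : (I : B) ⊠ X ⟶ X := leftT.app X

def lu' (X : B) : X ⟶ (I : B) ⊠ X := leftT.inv X

def luUnit (X : B) : 𝟙 ((I : B) ⊠ X) ≅ lu X ≫ lu' X := leftT.unit X

def luCounit (X : B) : lu' X ≫ lu X ≅ 𝟙 X := leftT.counit X

def luNat {X X' : B} (f : X ⟶ X') : (I : B) ⊠ˡ f ≫ lu X' ≅ lu X ≫ f := leftT.naturality f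

/-- The right unitor 1-cell. -/
def ru (X : B) : X ⊠ (I : B) ⟶ X := rightT.app X

def ru' (X : B) : X ⟶ X ⊠ (I : B) := rightT.inv X

def ruUnit (X : B) : 𝟙 (X ⊠ (I : B)) ≅ ru X ≫ ru' X := rightT.unit X

def ruCounit (X : B) : ru' X ≫ ru X ≅ 𝟙 X := rightT.counit X

def ruNat {X X' : B} (f : X ⟶ X') : f ⊠ʳ (I : B) ≫ ru X' ≅ ru X ≫ f := rightT.naturality f

end

/-- The invertible modifications of a monoidal bicategory: the pentagonator and the three unit
2-cells. -/
class PentagonBicategory (B : Type u) [Bicategory.{w, v} B] extends AssocUnitBicategory B where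
  pent (X Y Z T : B) :
    as X Y Z ⊠ʳ T ≫ as X (Y ⊠ Z) T ≫ X ⊠ˡ as Y Z T ≅ as (X ⊠ Y) Z T ≫ as X Y (Z ⊠ T)
  unitMid (X Y : B) : as X I Y ≫ X ⊠ˡ lu Y ≅ ru X ⊠ʳ Y
  unitLeft (X Y : B) : lu X ⊠ʳ Y ≅ as I X Y ≫ lu (X ⊠ Y)
  unitRight (X Y : B) : ru (X ⊠ Y) ≅ as X Y I ≫ X ⊠ˡ ru Y
  pent_mod {X X' Y Y' Z Z' T T' : B} (f : X ⟶ X') (g : Y ⟶ Y') (h : Z ⟶ Z') (k : T ⟶ T') :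
    SqCompat
      (sqComp (sqTensor (asNat f g h) (sqId k))
        (sqComp (asNat f (g ⊠₁ h) k) (sqTensor (sqId f) (asNat g h k))))
      (sqComp (asNat (f ⊠₁ g) h k) (asNat f g (h ⊠₁ k)))
      (pent X Y Z T) (pent X' Y' Z' T')
  unitMid_mod {X X' Y Y' : B} (f : X ⟶ X') (g : Y ⟶ Y') :
    SqCompat (sqComp (asNat f (𝟙 I) g) (sqTensor (sqId f) (luNat g)))
      (sqTensor (ruNat f) (sqId g)) (unitMid X Y) (unitMid X' Y')
  unitLeft_mod {X X' Y Y' : B} (f : X ⟶ X') (g : Y ⟶ Y') :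
    SqCompat (sqTensor (luNat f) (sqId g)) (sqComp (asNat (𝟙 I) f g) (luNat (f ⊠₁ g)))
      (unitLeft X Y) (unitLeft X' Y')
  unitRight_mod {X X' Y Y' : B} (f : X ⟶ X') (g : Y ⟶ Y') :
    SqCompat (ruNat (f ⊠₁ g)) (sqComp (asNat f g (𝟙 I)) (sqTensor (sqId f) (ruNat g)))
      (unitRight X Y) (unitRight X' Y')

section

variable {B : Type u} [Bicategory.{w, v} B] [PentagonBicategory B]

open PentagonBicategory

/-- The pentagonator tensored on the right with an object. -/
def pentR (X Y Z T U : B) :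
    (as X Y Z ⊠ʳ T) ⊠ʳ U ≫ as X (Y ⊠ Z) T ⊠ʳ U ≫ (X ⊠ˡ as Y Z T) ⊠ʳ U ≅
      as (X ⊠ Y) Z T ⊠ʳ U ≫ as X Y (Z ⊠ T) ⊠ʳ U :=
  tRComp₃ _ _ _ U ≪≫ tRIso (pent X Y Z T) U ≪≫ (tRComp _ _ U).symm

/-- The pentagonator tensored on the left with an object. -/
def pentL (X Y Z T U : B) :
    X ⊠ˡ (as Y Z T ⊠ʳ U) ≫ X ⊠ˡ as Y (Z ⊠ T) U ≫ X ⊠ˡ (Y ⊠ˡ as Z T U) ≅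
      X ⊠ˡ as (Y ⊠ Z) T U ≫ X ⊠ˡ as Y Z (T ⊠ U) :=
  tLComp₃ X _ _ _ ≪≫ tLIso X (pent Y Z T U) ≪≫ (tLComp X _ _).symm

/-- One side of the associahedron (non-abelian 4-cocycle) equation. -/
def assocRoute₁ (X Y Z T U : B) :
    (as X Y Z ⊠ʳ T) ⊠ʳ U ≫ as X (Y ⊠ Z) T ⊠ʳ U ≫ (X ⊠ˡ as Y Z T) ⊠ʳ U ≫
        as X (Y ⊠ (Z ⊠ T)) U ≫ X ⊠ˡ as Y (Z ⊠ T) U ≫ X ⊠ˡ (Y ⊠ˡ as Z T U) ≅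
      as ((X ⊠ Y) ⊠ Z) T U ≫ as (X ⊠ Y) Z (T ⊠ U) ≫ as X Y (Z ⊠ (T ⊠ U)) :=
  Iso.refl _ ≪⊗≫
    pentR X Y Z T U ▷ᵢ (as X (Y ⊠ (Z ⊠ T)) U ≫ X ⊠ˡ as Y (Z ⊠ T) U ≫ X ⊠ˡ (Y ⊠ˡ as Z T U)) ≪⊗≫
    (as (X ⊠ Y) Z T ⊠ʳ U) ◁ᵢ pent X Y (Z ⊠ T) U ▷ᵢ (X ⊠ˡ (Y ⊠ˡ as Z T U)) ≪⊗≫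
    (as (X ⊠ Y) Z T ⊠ʳ U ≫ as (X ⊠ Y) (Z ⊠ T) U) ◁ᵢ (asNat₃ X Y (as Z T U)).symm ≪⊗≫
    pent (X ⊠ Y) Z T U ▷ᵢ as X Y (Z ⊠ (T ⊠ U)) ≪⊗≫
    Iso.refl _

/-- The other side of the associahedron (non-abelian 4-cocycle) equation. -/
def assocRoute₂ (X Y Z T U : B) :
    (as X Y Z ⊠ʳ T) ⊠ʳ U ≫ as X (Y ⊠ Z) T ⊠ʳ U ≫ (X ⊠ˡ as Y Z T) ⊠ʳ U ≫
        as X (Y ⊠ (Z ⊠ T)) U ≫ X ⊠ˡ as Y (Z ⊠ T) U ≫ X ⊠ˡ (Y ⊠ˡ as Z T U) ≅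
      as ((X ⊠ Y) ⊠ Z) T U ≫ as (X ⊠ Y) Z (T ⊠ U) ≫ as X Y (Z ⊠ (T ⊠ U)) :=
  Iso.refl _ ≪⊗≫
    ((as X Y Z ⊠ʳ T) ⊠ʳ U ≫ as X (Y ⊠ Z) T ⊠ʳ U) ◁ᵢ asNat₂ X (as Y Z T) U ▷ᵢ
      (X ⊠ˡ as Y (Z ⊠ T) U ≫ X ⊠ˡ (Y ⊠ˡ as Z T U)) ≪⊗≫
    ((as X Y Z ⊠ʳ T) ⊠ʳ U ≫ as X (Y ⊠ Z) T ⊠ʳ U ≫ as X ((Y ⊠ Z) ⊠ T) U) ◁ᵢ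
      pentL X Y Z T U ≪⊗≫
    ((as X Y Z ⊠ʳ T) ⊠ʳ U) ◁ᵢ pent X (Y ⊠ Z) T U ▷ᵢ (X ⊠ˡ as Y Z (T ⊠ U)) ≪⊗≫
    asNat₁ (as X Y Z) T U ▷ᵢ (as X (Y ⊠ Z) (T ⊠ U) ≫ X ⊠ˡ as Y Z (T ⊠ U)) ≪⊗≫
    as ((X ⊠ Y) ⊠ Z) T U ◁ᵢ pent X Y Z (T ⊠ U) ≪⊗≫
    Iso.refl _

/-- One side of the left normalization equation. -/
def leftNormRoute₁ (X Y Z : B) :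
    as X I Y ⊠ʳ Z ≫ as X (I ⊠ Y) Z ≫ X ⊠ˡ as I Y Z ≫ X ⊠ˡ lu (Y ⊠ Z) ≅
      (ru X ⊠ʳ Y) ⊠ʳ Z ≫ as X Y Z :=
  Iso.refl _ ≪⊗≫
    pent X I Y Z ▷ᵢ (X ⊠ˡ lu (Y ⊠ Z)) ≪⊗≫
    as (X ⊠ I) Y Z ◁ᵢ unitMid X (Y ⊠ Z) ≪⊗≫
    (asNat₁ (ru X) Y Z).symm

/-- The other side of the left normalization equation. -/
def leftNormRoute₂ (X Y Z : B) :
    as X I Y ⊠ʳ Z ≫ as X (I ⊠ Y) Z ≫ X ⊠ˡ as I Y Z ≫ X ⊠ˡ lu (Y ⊠ Z) ≅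
      (ru X ⊠ʳ Y) ⊠ʳ Z ≫ as X Y Z :=
  Iso.refl _ ≪⊗≫
    (as X I Y ⊠ʳ Z ≫ as X (I ⊠ Y) Z) ◁ᵢ
      (tLComp X _ _ ≪≫ tLIso X (unitLeft Y Z).symm) ≪⊗≫
    (as X I Y ⊠ʳ Z) ◁ᵢ (asNat₂ X (lu Y) Z).symm ≪⊗≫
    (tRComp _ _ Z ≪≫ tRIso (unitMid X Y) Z) ▷ᵢ as X Y Z

/-- One side of the right normalization equation. -/
def rightNormRoute₁ (X Y Z : B) :
    as X Y I ⊠ʳ Z ≫ as X (Y ⊠ I) Z ≫ X ⊠ˡ as Y I Z ≫ X ⊠ˡ (Y ⊠ˡ lu Z) ≅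
      ru (X ⊠ Y) ⊠ʳ Z ≫ as X Y Z :=
  Iso.refl _ ≪⊗≫
    pent X Y I Z ▷ᵢ (X ⊠ˡ (Y ⊠ˡ lu Z)) ≪⊗≫
    as (X ⊠ Y) I Z ◁ᵢ (asNat₃ X Y (lu Z)).symm ≪⊗≫
    unitMid (X ⊠ Y) Z ▷ᵢ as X Y Z

/-- The other side of the right normalization equation. -/
def rightNormRoute₂ (X Y Z : B) :
    as X Y I ⊠ʳ Z ≫ as X (Y ⊠ I) Z ≫ X ⊠ˡ as Y I Z ≫ X ⊠ˡ (Y ⊠ˡ lu Z) ≅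
      ru (X ⊠ Y) ⊠ʳ Z ≫ as X Y Z :=
  Iso.refl _ ≪⊗≫
    (as X Y I ⊠ʳ Z ≫ as X (Y ⊠ I) Z) ◁ᵢ (tLComp X _ _ ≪≫ tLIso X (unitMid Y Z)) ≪⊗≫
    (as X Y I ⊠ʳ Z) ◁ᵢ (asNat₂ X (ru Y) Z).symm ≪⊗≫
    (tRComp _ _ Z ≪≫ tRIso (unitRight X Y).symm Z) ▷ᵢ as X Y Z

end

/-- Monoidal bicategories, in fully weak form. -/
class MonoidalBicategory (B : Type u) [Bicategory.{w, v} B] extends PentagonBicategory B where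
  associahedron (X Y Z T U : B) : assocRoute₁ X Y Z T U = assocRoute₂ X Y Z T U
  left_normalization (X Y Z : B) : leftNormRoute₁ X Y Z = leftNormRoute₂ X Y Z
  right_normalization (X Y Z : B) : rightNormRoute₁ X Y Z = rightNormRoute₂ X Y Z

end Monoidal

section Symmetric

open TensorBicategory PentagonBicategory

local infixr:85 " ⊠ " => tObj
local infixr:85 " ⊠₁ " => tHom
local infixr:85 " ⊠ˡ " => tL
local infixl:85 " ⊠ʳ " => tR

section

variable {B : Type u} [Bicategory.{w, v} B] [MonoidalBicategory B]

/-- A mate of the pentagonator. -/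
def pentMate₁ (X Y Z T : B) :
    as' X Y Z ⊠ʳ T ≫ as (X ⊠ Y) Z T ≅
      as X (Y ⊠ Z) T ≫ X ⊠ˡ as Y Z T ≫ as' X Y (Z ⊠ T) :=
  Iso.refl _ ≪⊗≫
    (as' X Y Z ⊠ʳ T ≫ as (X ⊠ Y) Z T) ◁ᵢ asUnit X Y (Z ⊠ T) ≪⊗≫
    (as' X Y Z ⊠ʳ T) ◁ᵢ (pent X Y Z T).symm ▷ᵢ as' X Y (Z ⊠ T) ≪⊗≫
    (tRComp _ _ T ≪≫ tRIso (asCounit X Y Z) T ≪≫ tId _ _) ▷ᵢ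
      (as X (Y ⊠ Z) T ≫ X ⊠ˡ as Y Z T ≫ as' X Y (Z ⊠ T)) ≪⊗≫
    Iso.refl _

/-- A mate of the pentagonator. -/
def pentMate₂ (X Y Z T : B) :
    as' (X ⊠ Y) Z T ≫ as X Y Z ⊠ʳ T ≫ as X (Y ⊠ Z) T ≅
      as X Y (Z ⊠ T) ≫ X ⊠ˡ as' Y Z T :=
  Iso.refl _ ≪⊗≫
    (as' (X ⊠ Y) Z T ≫ as X Y Z ⊠ʳ T ≫ as X (Y ⊠ Z) T) ◁ᵢ
      ((tId _ _).symm ≪≫ tLIso X (asUnit Y Z T) ≪≫ (tLComp X _ _).symm) ≪⊗≫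
    as' (X ⊠ Y) Z T ◁ᵢ pent X Y Z T ▷ᵢ (X ⊠ˡ as' Y Z T) ≪⊗≫
    asCounit (X ⊠ Y) Z T ▷ᵢ (as X Y (Z ⊠ T) ≫ X ⊠ˡ as' Y Z T) ≪⊗≫
    Iso.refl _

/-- A mate of the pentagonator. -/
def pentMate₃ (X Y Z T : B) :
    X ⊠ˡ as Y Z T ≫ as' X Y (Z ⊠ T) ≫ as' (X ⊠ Y) Z T ≫ as X Y Z ⊠ʳ T ≅
      as' X (Y ⊠ Z) T :=
  Iso.refl _ ≪⊗≫
    (asCounit X (Y ⊠ Z) T).symm ▷ᵢ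
      (X ⊠ˡ as Y Z T ≫ as' X Y (Z ⊠ T) ≫ as' (X ⊠ Y) Z T ≫ as X Y Z ⊠ʳ T) ≪⊗≫
    as' X (Y ⊠ Z) T ◁ᵢ ((tId _ _).symm ≪≫ tRIso (asCounit X Y Z).symm T ≪≫
      (tRComp _ _ T).symm) ▷ᵢ (as X (Y ⊠ Z) T ≫ X ⊠ˡ as Y Z T ≫ as' X Y (Z ⊠ T) ≫
        as' (X ⊠ Y) Z T ≫ as X Y Z ⊠ʳ T) ≪⊗≫
    (as' X (Y ⊠ Z) T ≫ as' X Y Z ⊠ʳ T) ◁ᵢ pent X Y Z T ▷ᵢ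
      (as' X Y (Z ⊠ T) ≫ as' (X ⊠ Y) Z T ≫ as X Y Z ⊠ʳ T) ≪⊗≫
    (as' X (Y ⊠ Z) T ≫ as' X Y Z ⊠ʳ T ≫ as (X ⊠ Y) Z T) ◁ᵢ (asUnit X Y (Z ⊠ T)).symm ▷ᵢ
      (as' (X ⊠ Y) Z T ≫ as X Y Z ⊠ʳ T) ≪⊗≫
    (as' X (Y ⊠ Z) T ≫ as' X Y Z ⊠ʳ T) ◁ᵢ (asUnit (X ⊠ Y) Z T).symm ▷ᵢ
      (as X Y Z ⊠ʳ T) ≪⊗≫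
    as' X (Y ⊠ Z) T ◁ᵢ (tRComp _ _ T ≪≫ tRIso (asCounit X Y Z) T ≪≫ tId _ _) ≪⊗≫
    Iso.refl _

end

/-- A braiding 1-cell on a monoidal bicategory, as a pseudonatural equivalence. -/
class BraidingBicategory (B : Type u) [Bicategory.{w, v} B] extends MonoidalBicategory B where
  braidT : PseudonatEquiv (tensor : (B × B) ⥤ᵖ B) (tensorOp B)

section

variable {B : Type u} [Bicategory.{w, v} B] [BraidingBicategory B]

open BraidingBicategory

/-- The braiding 1-cell. -/
def br (X Y : B) : X ⊠ Y ⟶ Y ⊠ X := braidT.app (X, Y)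

def brNat {X X' Y Y' : B} (f : X ⟶ X') (g : Y ⟶ Y') :
    f ⊠₁ g ≫ br X' Y' ≅ br X Y ≫ g ⊠₁ f :=
  braidT.naturality (a := (X, Y)) (b := (X', Y')) (f, g)

end

/-- The invertible modifications of a symmetric monoidal bicategory: the two hexagonators
and the syllepsis. The second hexagonator, often given as an isomorphism from
`X ⊠ˡ br Y Z ≫ as' X Z Y ≫ br X Z ⊠ʳ Y` to `as' X Y Z ≫ br (X ⊠ Y) Z ≫ as' Z X Y`, is recorded
here through its mate under the adjoint equivalences `as`, `as'`. -/
class HexagonBicategory (B : Type u) [Bicategory.{w, v} B] extends BraidingBicategory B where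
  hex₁ (X Y Z : B) :
    br X Y ⊠ʳ Z ≫ as Y X Z ≫ Y ⊠ˡ br X Z ≅ as X Y Z ≫ br X (Y ⊠ Z) ≫ as Y Z X
  hex₂ (X Y Z : B) :
    as X Y Z ≫ X ⊠ˡ br Y Z ≫ as' X Z Y ≫ br X Z ⊠ʳ Y ≫ as Z X Y ≅ br (X ⊠ Y) Z
  syll (X Y : B) : 𝟙 (X ⊠ Y) ≅ br X Y ≫ br Y X
  hex₁_mod {X X' Y Y' Z Z' : B} (f : X ⟶ X') (g : Y ⟶ Y') (h : Z ⟶ Z') :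
    SqCompat
      (sqComp (sqTensor (brNat f g) (sqId h))
        (sqComp (asNat g f h) (sqTensor (sqId g) (brNat f h))))
      (sqComp (asNat f g h) (sqComp (brNat f (g ⊠₁ h)) (asNat g h f)))
      (hex₁ X Y Z) (hex₁ X' Y' Z')
  hex₂_mod {X X' Y Y' Z Z' : B} (f : X ⟶ X') (g : Y ⟶ Y') (h : Z ⟶ Z') :
    SqCompat
      (sqComp (asNat f g h) (sqComp (sqTensor (sqId f) (brNat g h)) (sqComp (asNat' f h g)
        (sqComp (sqTensor (brNat f h) (sqId g)) (asNat h f g)))))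
      (brNat (f ⊠₁ g) h)
      (hex₂ X Y Z) (hex₂ X' Y' Z')
  syll_mod {X X' Y Y' : B} (f : X ⟶ X') (g : Y ⟶ Y') :
    SqCompat (sqId (f ⊠₁ g)) (sqComp (brNat f g) (brNat g f)) (syll X Y) (syll X' Y')

section

variable {B : Type u} [Bicategory.{w, v} B] [HexagonBicategory B]

open HexagonBicategory

/-- `hex₁` tensored on the right with an object. -/
def hex₁R (X Y Z T : B) :
    (br X Y ⊠ʳ Z) ⊠ʳ T ≫ as Y X Z ⊠ʳ T ≫ (Y ⊠ˡ br X Z) ⊠ʳ T ≅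
      as X Y Z ⊠ʳ T ≫ br X (Y ⊠ Z) ⊠ʳ T ≫ as Y Z X ⊠ʳ T :=
  tRComp₃ _ _ _ T ≪≫ tRIso (hex₁ X Y Z) T ≪≫ (tRComp₃ _ _ _ T).symm

/-- `hex₁` tensored on the left with an object. -/
def hex₁L (X Y Z T : B) :
    X ⊠ˡ (br Y Z ⊠ʳ T) ≫ X ⊠ˡ as Z Y T ≫ X ⊠ˡ (Z ⊠ˡ br Y T) ≅
      X ⊠ˡ as Y Z T ≫ X ⊠ˡ br Y (Z ⊠ T) ≫ X ⊠ˡ as Z T Y :=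
  tLComp₃ X _ _ _ ≪≫ tLIso X (hex₁ Y Z T) ≪≫ (tLComp₃ X _ _ _).symm

def tRComp₅ {X₁ X₂ X₃ X₄ X₅ X₆ : B} (f₁ : X₁ ⟶ X₂) (f₂ : X₂ ⟶ X₃) (f₃ : X₃ ⟶ X₄)
    (f₄ : X₄ ⟶ X₅) (f₅ : X₅ ⟶ X₆) (Y : B) :
    f₁ ⊠ʳ Y ≫ f₂ ⊠ʳ Y ≫ f₃ ⊠ʳ Y ≫ f₄ ⊠ʳ Y ≫ f₅ ⊠ʳ Y ≅ (f₁ ≫ f₂ ≫ f₃ ≫ f₄ ≫ f₅) ⊠ʳ Y :=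
  whiskerLeftIso _ (whiskerLeftIso _ (tRComp₃ f₃ f₄ f₅ Y) ≪≫ tRComp f₂ _ Y) ≪≫ tRComp f₁ _ Y

def tLComp₅ {X₁ X₂ X₃ X₄ X₅ X₆ : B} (Y : B) (f₁ : X₁ ⟶ X₂) (f₂ : X₂ ⟶ X₃) (f₃ : X₃ ⟶ X₄)
    (f₄ : X₄ ⟶ X₅) (f₅ : X₅ ⟶ X₆) :
    Y ⊠ˡ f₁ ≫ Y ⊠ˡ f₂ ≫ Y ⊠ˡ f₃ ≫ Y ⊠ˡ f₄ ≫ Y ⊠ˡ f₅ ≅ Y ⊠ˡ (f₁ ≫ f₂ ≫ f₃ ≫ f₄ ≫ f₅) :=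
  whiskerLeftIso _ (whiskerLeftIso _ (tLComp₃ Y f₃ f₄ f₅) ≪≫ tLComp Y f₂ _) ≪≫ tLComp Y f₁ _

/-- `hex₂` tensored on the right with an object. -/
def hex₂R (X Y Z T : B) :
    as X Y Z ⊠ʳ T ≫ (X ⊠ˡ br Y Z) ⊠ʳ T ≫ as' X Z Y ⊠ʳ T ≫ (br X Z ⊠ʳ Y) ⊠ʳ T ≫
      as Z X Y ⊠ʳ T ≅ br (X ⊠ Y) Z ⊠ʳ T :=
  tRComp₅ _ _ _ _ _ T ≪≫ tRIso (hex₂ X Y Z) T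

/-- `hex₂` tensored on the left with an object. -/
def hex₂L (X Y Z T : B) :
    X ⊠ˡ as Y Z T ≫ X ⊠ˡ (Y ⊠ˡ br Z T) ≫ X ⊠ˡ as' Y T Z ≫ X ⊠ˡ (br Y T ⊠ʳ Z) ≫
      X ⊠ˡ as T Y Z ≅ X ⊠ˡ br (Y ⊠ Z) T :=
  tLComp₅ X _ _ _ _ _ ≪≫ tLIso X (hex₂ Y Z T)

/-- Moving one object past three, one side. -/
def shuffle₁₃Route₁ (X Y Z T : B) :
    (br X Y ⊠ʳ Z) ⊠ʳ T ≫ as Y X Z ⊠ʳ T ≫ (Y ⊠ˡ br X Z) ⊠ʳ T ≫ as Y (Z ⊠ X) T ≫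
        Y ⊠ˡ as Z X T ≫ Y ⊠ˡ (Z ⊠ˡ br X T) ≅
      as (X ⊠ Y) Z T ≫ as X Y (Z ⊠ T) ≫ br X (Y ⊠ (Z ⊠ T)) ≫ as Y (Z ⊠ T) X ≫
        Y ⊠ˡ as Z T X :=
  Iso.refl _ ≪⊗≫
    hex₁R X Y Z T ▷ᵢ (as Y (Z ⊠ X) T ≫ Y ⊠ˡ as Z X T ≫ Y ⊠ˡ (Z ⊠ˡ br X T)) ≪⊗≫
    (as X Y Z ⊠ʳ T ≫ br X (Y ⊠ Z) ⊠ʳ T) ◁ᵢ pent Y Z X T ▷ᵢ (Y ⊠ˡ (Z ⊠ˡ br X T)) ≪⊗≫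
    (as X Y Z ⊠ʳ T ≫ br X (Y ⊠ Z) ⊠ʳ T ≫ as (Y ⊠ Z) X T) ◁ᵢ
      (asNat₃ Y Z (br X T)).symm ≪⊗≫
    (as X Y Z ⊠ʳ T) ◁ᵢ hex₁ X (Y ⊠ Z) T ▷ᵢ as Y Z (T ⊠ X) ≪⊗≫
    (as X Y Z ⊠ʳ T ≫ as X (Y ⊠ Z) T ≫ br X ((Y ⊠ Z) ⊠ T)) ◁ᵢ (pent Y Z T X).symm ≪⊗≫
    (as X Y Z ⊠ʳ T ≫ as X (Y ⊠ Z) T) ◁ᵢ (brNat (𝟙 X) (as Y Z T)).symm ▷ᵢ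
      (as Y (Z ⊠ T) X ≫ Y ⊠ˡ as Z T X) ≪⊗≫
    pent X Y Z T ▷ᵢ (br X (Y ⊠ (Z ⊠ T)) ≫ as Y (Z ⊠ T) X ≫ Y ⊠ˡ as Z T X) ≪⊗≫
    Iso.refl _

/-- Moving one object past three, the other side. -/
def shuffle₁₃Route₂ (X Y Z T : B) :
    (br X Y ⊠ʳ Z) ⊠ʳ T ≫ as Y X Z ⊠ʳ T ≫ (Y ⊠ˡ br X Z) ⊠ʳ T ≫ as Y (Z ⊠ X) T ≫
        Y ⊠ˡ as Z X T ≫ Y ⊠ˡ (Z ⊠ˡ br X T) ≅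
      as (X ⊠ Y) Z T ≫ as X Y (Z ⊠ T) ≫ br X (Y ⊠ (Z ⊠ T)) ≫ as Y (Z ⊠ T) X ≫
        Y ⊠ˡ as Z T X :=
  Iso.refl _ ≪⊗≫
    ((br X Y ⊠ʳ Z) ⊠ʳ T ≫ as Y X Z ⊠ʳ T) ◁ᵢ asNat₂ Y (br X Z) T ▷ᵢ
      (Y ⊠ˡ as Z X T ≫ Y ⊠ˡ (Z ⊠ˡ br X T)) ≪⊗≫
    ((br X Y ⊠ʳ Z) ⊠ʳ T ≫ as Y X Z ⊠ʳ T ≫ as Y (X ⊠ Z) T) ◁ᵢ hex₁L Y X Z T ≪⊗≫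
    ((br X Y ⊠ʳ Z) ⊠ʳ T) ◁ᵢ pent Y X Z T ▷ᵢ
      (Y ⊠ˡ br X (Z ⊠ T) ≫ Y ⊠ˡ as Z T X) ≪⊗≫
    asNat₁ (br X Y) Z T ▷ᵢ
      (as Y X (Z ⊠ T) ≫ Y ⊠ˡ br X (Z ⊠ T) ≫ Y ⊠ˡ as Z T X) ≪⊗≫
    as (X ⊠ Y) Z T ◁ᵢ hex₁ X Y (Z ⊠ T) ▷ᵢ (Y ⊠ˡ as Z T X) ≪⊗≫
    Iso.refl _

/-- Moving three objects past one, one side: expanding `br ((X ⊠ Y) ⊠ Z) T` directly. -/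
def shuffle₃₁Route₁ (X Y Z T : B) :
    as (X ⊠ Y) Z T ≫ (X ⊠ Y) ⊠ˡ br Z T ≫ as' (X ⊠ Y) T Z ≫
        (as X Y T ⊠ʳ Z ≫ (X ⊠ˡ br Y T) ⊠ʳ Z ≫ as' X T Y ⊠ʳ Z ≫ (br X T ⊠ʳ Y) ⊠ʳ Z ≫
          as T X Y ⊠ʳ Z) ≫ as T (X ⊠ Y) Z ≫ T ⊠ˡ as X Y Z ≅
      as X Y Z ⊠ʳ T ≫ br (X ⊠ (Y ⊠ Z)) T :=
  Iso.refl _ ≪⊗≫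
    (as (X ⊠ Y) Z T ≫ (X ⊠ Y) ⊠ˡ br Z T ≫ as' (X ⊠ Y) T Z) ◁ᵢ hex₂R X Y T Z ▷ᵢ
      (as T (X ⊠ Y) Z ≫ T ⊠ˡ as X Y Z) ≪⊗≫
    hex₂ (X ⊠ Y) Z T ▷ᵢ (T ⊠ˡ as X Y Z) ≪⊗≫
    (brNat (as X Y Z) (𝟙 T)).symm

/-- Moving three objects past one, the other side. -/
def shuffle₃₁Route₂ (X Y Z T : B) :
    as (X ⊠ Y) Z T ≫ (X ⊠ Y) ⊠ˡ br Z T ≫ as' (X ⊠ Y) T Z ≫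
        (as X Y T ⊠ʳ Z ≫ (X ⊠ˡ br Y T) ⊠ʳ Z ≫ as' X T Y ⊠ʳ Z ≫ (br X T ⊠ʳ Y) ⊠ʳ Z ≫
          as T X Y ⊠ʳ Z) ≫ as T (X ⊠ Y) Z ≫ T ⊠ˡ as X Y Z ≅
      as X Y Z ⊠ʳ T ≫ br (X ⊠ (Y ⊠ Z)) T :=
  Iso.refl _ ≪⊗≫
    (as (X ⊠ Y) Z T ≫ (X ⊠ Y) ⊠ˡ br Z T ≫ as' (X ⊠ Y) T Z ≫ as X Y T ⊠ʳ Z ≫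
      (X ⊠ˡ br Y T) ⊠ʳ Z ≫ as' X T Y ⊠ʳ Z ≫ (br X T ⊠ʳ Y) ⊠ʳ Z) ◁ᵢ pent T X Y Z ≪⊗≫
    (as (X ⊠ Y) Z T ≫ (X ⊠ Y) ⊠ˡ br Z T ≫ as' (X ⊠ Y) T Z ≫ as X Y T ⊠ʳ Z ≫
      (X ⊠ˡ br Y T) ⊠ʳ Z ≫ as' X T Y ⊠ʳ Z) ◁ᵢ asNat₁ (br X T) Y Z ▷ᵢ
        as T X (Y ⊠ Z) ≪⊗≫
    (as (X ⊠ Y) Z T ≫ (X ⊠ Y) ⊠ˡ br Z T ≫ as' (X ⊠ Y) T Z ≫ as X Y T ⊠ʳ Z ≫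
      (X ⊠ˡ br Y T) ⊠ʳ Z) ◁ᵢ pentMate₁ X T Y Z ▷ᵢ
        (br X T ⊠ʳ (Y ⊠ Z) ≫ as T X (Y ⊠ Z)) ≪⊗≫
    (as (X ⊠ Y) Z T ≫ (X ⊠ Y) ⊠ˡ br Z T ≫ as' (X ⊠ Y) T Z ≫ as X Y T ⊠ʳ Z) ◁ᵢ
      asNat₂ X (br Y T) Z ▷ᵢ
        (X ⊠ˡ as T Y Z ≫ as' X T (Y ⊠ Z) ≫ br X T ⊠ʳ (Y ⊠ Z) ≫ as T X (Y ⊠ Z)) ≪⊗≫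
    (as (X ⊠ Y) Z T ≫ (X ⊠ Y) ⊠ˡ br Z T) ◁ᵢ pentMate₂ X Y T Z ▷ᵢ
      (X ⊠ˡ (br Y T ⊠ʳ Z) ≫ X ⊠ˡ as T Y Z ≫ as' X T (Y ⊠ Z) ≫ br X T ⊠ʳ (Y ⊠ Z) ≫
        as T X (Y ⊠ Z)) ≪⊗≫
    as (X ⊠ Y) Z T ◁ᵢ asNat₃ X Y (br Z T) ▷ᵢ
      (X ⊠ˡ as' Y T Z ≫ X ⊠ˡ (br Y T ⊠ʳ Z) ≫ X ⊠ˡ as T Y Z ≫ as' X T (Y ⊠ Z) ≫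
        br X T ⊠ʳ (Y ⊠ Z) ≫ as T X (Y ⊠ Z)) ≪⊗≫
    (pent X Y Z T).symm ▷ᵢ
      (X ⊠ˡ (Y ⊠ˡ br Z T) ≫ X ⊠ˡ as' Y T Z ≫ X ⊠ˡ (br Y T ⊠ʳ Z) ≫ X ⊠ˡ as T Y Z ≫
        as' X T (Y ⊠ Z) ≫ br X T ⊠ʳ (Y ⊠ Z) ≫ as T X (Y ⊠ Z)) ≪⊗≫
    (as X Y Z ⊠ʳ T ≫ as X (Y ⊠ Z) T) ◁ᵢ hex₂L X Y Z T ▷ᵢ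
      (as' X T (Y ⊠ Z) ≫ br X T ⊠ʳ (Y ⊠ Z) ≫ as T X (Y ⊠ Z)) ≪⊗≫
    (as X Y Z ⊠ʳ T) ◁ᵢ hex₂ X (Y ⊠ Z) T

/-- Moving two objects past two, one side: the pair `X ⊠ Y` is moved as a unit. -/
def shuffle₂₂Route₁ (X Y Z T : B) :
    (as X Y Z ⊠ʳ T ≫ (X ⊠ˡ br Y Z) ⊠ʳ T ≫ as' X Z Y ⊠ʳ T ≫ (br X Z ⊠ʳ Y) ⊠ʳ T ≫
        as Z X Y ⊠ʳ T) ≫ as Z (X ⊠ Y) T ≫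
        (Z ⊠ˡ as X Y T ≫ Z ⊠ˡ (X ⊠ˡ br Y T) ≫ Z ⊠ˡ as' X T Y ≫ Z ⊠ˡ (br X T ⊠ʳ Y) ≫
          Z ⊠ˡ as T X Y) ≅
      as (X ⊠ Y) Z T ≫ br (X ⊠ Y) (Z ⊠ T) ≫ as Z T (X ⊠ Y) :=
  Iso.refl _ ≪⊗≫
    hex₂R X Y Z T ▷ᵢ (as Z (X ⊠ Y) T ≫
      (Z ⊠ˡ as X Y T ≫ Z ⊠ˡ (X ⊠ˡ br Y T) ≫ Z ⊠ˡ as' X T Y ≫ Z ⊠ˡ (br X T ⊠ʳ Y) ≫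
        Z ⊠ˡ as T X Y)) ≪⊗≫
    (br (X ⊠ Y) Z ⊠ʳ T ≫ as Z (X ⊠ Y) T) ◁ᵢ hex₂L Z X Y T ≪⊗≫
    hex₁ (X ⊠ Y) Z T

/-- Moving two objects past two, the other side: the pair `Z ⊠ T` is moved as a unit. -/
def shuffle₂₂Route₂ (X Y Z T : B) :
    (as X Y Z ⊠ʳ T ≫ (X ⊠ˡ br Y Z) ⊠ʳ T ≫ as' X Z Y ⊠ʳ T ≫ (br X Z ⊠ʳ Y) ⊠ʳ T ≫
        as Z X Y ⊠ʳ T) ≫ as Z (X ⊠ Y) T ≫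
        (Z ⊠ˡ as X Y T ≫ Z ⊠ˡ (X ⊠ˡ br Y T) ≫ Z ⊠ˡ as' X T Y ≫ Z ⊠ˡ (br X T ⊠ʳ Y) ≫
          Z ⊠ˡ as T X Y) ≅
      as (X ⊠ Y) Z T ≫ br (X ⊠ Y) (Z ⊠ T) ≫ as Z T (X ⊠ Y) :=
  Iso.refl _ ≪⊗≫
    (as X Y Z ⊠ʳ T ≫ (X ⊠ˡ br Y Z) ⊠ʳ T ≫ as' X Z Y ⊠ʳ T ≫ (br X Z ⊠ʳ Y) ⊠ʳ T) ◁ᵢ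
      pent Z X Y T ▷ᵢ
        (Z ⊠ˡ (X ⊠ˡ br Y T) ≫ Z ⊠ˡ as' X T Y ≫ Z ⊠ˡ (br X T ⊠ʳ Y) ≫ Z ⊠ˡ as T X Y) ≪⊗≫
    (as X Y Z ⊠ʳ T ≫ (X ⊠ˡ br Y Z) ⊠ʳ T ≫ as' X Z Y ⊠ʳ T) ◁ᵢ
      asNat₁ (br X Z) Y T ▷ᵢ (as Z X (Y ⊠ T) ≫
        Z ⊠ˡ (X ⊠ˡ br Y T) ≫ Z ⊠ˡ as' X T Y ≫ Z ⊠ˡ (br X T ⊠ʳ Y) ≫ Z ⊠ˡ as T X Y) ≪⊗≫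
    (as X Y Z ⊠ʳ T ≫ (X ⊠ˡ br Y Z) ⊠ʳ T ≫ as' X Z Y ⊠ʳ T ≫ as (X ⊠ Z) Y T ≫
      br X Z ⊠ʳ (Y ⊠ T)) ◁ᵢ (asNat₃ Z X (br Y T)).symm ▷ᵢ
        (Z ⊠ˡ as' X T Y ≫ Z ⊠ˡ (br X T ⊠ʳ Y) ≫ Z ⊠ˡ as T X Y) ≪⊗≫
    (as X Y Z ⊠ʳ T ≫ (X ⊠ˡ br Y Z) ⊠ʳ T ≫ as' X Z Y ⊠ʳ T ≫ as (X ⊠ Z) Y T) ◁ᵢ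
      tSwap (br X Z) (br Y T) ▷ᵢ (as Z X (T ⊠ Y) ≫
        Z ⊠ˡ as' X T Y ≫ Z ⊠ˡ (br X T ⊠ʳ Y) ≫ Z ⊠ˡ as T X Y) ≪⊗≫
    (as X Y Z ⊠ʳ T ≫ (X ⊠ˡ br Y Z) ⊠ʳ T) ◁ᵢ pentMate₁ X Z Y T ▷ᵢ
      ((X ⊠ Z) ⊠ˡ br Y T ≫ br X Z ⊠ʳ (T ⊠ Y) ≫ as Z X (T ⊠ Y) ≫
        Z ⊠ˡ as' X T Y ≫ Z ⊠ˡ (br X T ⊠ʳ Y) ≫ Z ⊠ˡ as T X Y) ≪⊗≫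
    (as X Y Z ⊠ʳ T) ◁ᵢ asNat₂ X (br Y Z) T ▷ᵢ
      (X ⊠ˡ as Z Y T ≫ as' X Z (Y ⊠ T) ≫ (X ⊠ Z) ⊠ˡ br Y T ≫ br X Z ⊠ʳ (T ⊠ Y) ≫
        as Z X (T ⊠ Y) ≫ Z ⊠ˡ as' X T Y ≫ Z ⊠ˡ (br X T ⊠ʳ Y) ≫ Z ⊠ˡ as T X Y) ≪⊗≫
    (as X Y Z ⊠ʳ T ≫ as X (Y ⊠ Z) T ≫ X ⊠ˡ (br Y Z ⊠ʳ T) ≫ X ⊠ˡ as Z Y T) ◁ᵢ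
      (asNat₃' X Z (br Y T)).symm ▷ᵢ (br X Z ⊠ʳ (T ⊠ Y) ≫
        as Z X (T ⊠ Y) ≫ Z ⊠ˡ as' X T Y ≫ Z ⊠ˡ (br X T ⊠ʳ Y) ≫ Z ⊠ˡ as T X Y) ≪⊗≫
    (as X Y Z ⊠ʳ T ≫ as X (Y ⊠ Z) T) ◁ᵢ hex₁L X Y Z T ▷ᵢ (as' X Z (T ⊠ Y) ≫
      br X Z ⊠ʳ (T ⊠ Y) ≫ as Z X (T ⊠ Y) ≫ Z ⊠ˡ as' X T Y ≫ Z ⊠ˡ (br X T ⊠ʳ Y) ≫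
        Z ⊠ˡ as T X Y) ≪⊗≫
    (as X Y Z ⊠ʳ T ≫ as X (Y ⊠ Z) T ≫ X ⊠ˡ as Y Z T ≫ X ⊠ˡ br Y (Z ⊠ T) ≫
      X ⊠ˡ as Z T Y ≫ as' X Z (T ⊠ Y) ≫ br X Z ⊠ʳ (T ⊠ Y)) ◁ᵢ (pentMate₂ Z X T Y).symm ▷ᵢ
        (Z ⊠ˡ (br X T ⊠ʳ Y) ≫ Z ⊠ˡ as T X Y) ≪⊗≫
    (as X Y Z ⊠ʳ T ≫ as X (Y ⊠ Z) T ≫ X ⊠ˡ as Y Z T ≫ X ⊠ˡ br Y (Z ⊠ T) ≫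
      X ⊠ˡ as Z T Y ≫ as' X Z (T ⊠ Y)) ◁ᵢ asNat₁' (br X Z) T Y ▷ᵢ
        (as Z X T ⊠ʳ Y ≫ as Z (X ⊠ T) Y ≫ Z ⊠ˡ (br X T ⊠ʳ Y) ≫ Z ⊠ˡ as T X Y) ≪⊗≫
    (as X Y Z ⊠ʳ T ≫ as X (Y ⊠ Z) T ≫ X ⊠ˡ as Y Z T ≫ X ⊠ˡ br Y (Z ⊠ T) ≫
      X ⊠ˡ as Z T Y ≫ as' X Z (T ⊠ Y) ≫ as' (X ⊠ Z) T Y ≫ (br X Z ⊠ʳ T) ⊠ʳ Y ≫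
        as Z X T ⊠ʳ Y) ◁ᵢ (asNat₂ Z (br X T) Y).symm ▷ᵢ (Z ⊠ˡ as T X Y) ≪⊗≫
    (as X Y Z ⊠ʳ T ≫ as X (Y ⊠ Z) T ≫ X ⊠ˡ as Y Z T ≫ X ⊠ˡ br Y (Z ⊠ T) ≫
      X ⊠ˡ as Z T Y ≫ as' X Z (T ⊠ Y) ≫ as' (X ⊠ Z) T Y) ◁ᵢ hex₁R X Z T Y ▷ᵢ
        (as Z (T ⊠ X) Y ≫ Z ⊠ˡ as T X Y) ≪⊗≫
    (as X Y Z ⊠ʳ T ≫ as X (Y ⊠ Z) T ≫ X ⊠ˡ as Y Z T ≫ X ⊠ˡ br Y (Z ⊠ T)) ◁ᵢ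
      pentMate₃ X Z T Y ▷ᵢ (br X (Z ⊠ T) ⊠ʳ Y ≫ as Z T X ⊠ʳ Y ≫
        as Z (T ⊠ X) Y ≫ Z ⊠ˡ as T X Y) ≪⊗≫
    pent X Y Z T ▷ᵢ (X ⊠ˡ br Y (Z ⊠ T) ≫ as' X (Z ⊠ T) Y ≫ br X (Z ⊠ T) ⊠ʳ Y ≫
      as Z T X ⊠ʳ Y ≫ as Z (T ⊠ X) Y ≫ Z ⊠ˡ as T X Y) ≪⊗≫
    (as (X ⊠ Y) Z T ≫ as X Y (Z ⊠ T) ≫ X ⊠ˡ br Y (Z ⊠ T) ≫ as' X (Z ⊠ T) Y ≫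
      br X (Z ⊠ T) ⊠ʳ Y) ◁ᵢ pent Z T X Y ≪⊗≫
    as (X ⊠ Y) Z T ◁ᵢ hex₂ X Y (Z ⊠ T) ▷ᵢ as Z T (X ⊠ Y) ≪⊗≫
    Iso.refl _

/-- The Yang-Baxter (Breen) equation, one side: naturality of the braiding in its first
argument. -/
def breenRoute₁ (X Y Z : B) :
    br X Y ⊠ʳ Z ≫ as Y X Z ≫ Y ⊠ˡ br X Z ≫ as' Y Z X ≫ br Y Z ⊠ʳ X ≫ as Z Y X ≅
      as X Y Z ≫ X ⊠ˡ br Y Z ≫ as' X Z Y ≫ br X Z ⊠ʳ Y ≫ as Z X Y ≫ Z ⊠ˡ br X Y :=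
  Iso.refl _ ≪⊗≫
    (br X Y ⊠ʳ Z) ◁ᵢ hex₂ Y X Z ≪⊗≫
    brNat (br X Y) (𝟙 Z) ≪⊗≫
    (hex₂ X Y Z).symm ▷ᵢ (Z ⊠ˡ br X Y) ≪⊗≫
    Iso.refl _

/-- The Yang-Baxter (Breen) equation, the other side: naturality of the braiding in its second
argument. -/
def breenRoute₂ (X Y Z : B) :
    br X Y ⊠ʳ Z ≫ as Y X Z ≫ Y ⊠ˡ br X Z ≫ as' Y Z X ≫ br Y Z ⊠ʳ X ≫ as Z Y X ≅
      as X Y Z ≫ X ⊠ˡ br Y Z ≫ as' X Z Y ≫ br X Z ⊠ʳ Y ≫ as Z X Y ≫ Z ⊠ˡ br X Y :=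
  Iso.refl _ ≪⊗≫
    hex₁ X Y Z ▷ᵢ (as' Y Z X ≫ br Y Z ⊠ʳ X ≫ as Z Y X) ≪⊗≫
    (as X Y Z ≫ br X (Y ⊠ Z)) ◁ᵢ (asUnit Y Z X).symm ▷ᵢ (br Y Z ⊠ʳ X ≫ as Z Y X) ≪⊗≫
    as X Y Z ◁ᵢ (brNat (𝟙 X) (br Y Z)).symm ▷ᵢ as Z Y X ≪⊗≫
    (as X Y Z ≫ X ⊠ˡ br Y Z) ◁ᵢ (asCounit X Z Y).symm ▷ᵢ (br X (Z ⊠ Y) ≫ as Z Y X) ≪⊗≫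
    (as X Y Z ≫ X ⊠ˡ br Y Z ≫ as' X Z Y) ◁ᵢ (hex₁ X Z Y).symm ≪⊗≫
    Iso.refl _

/-- Compatibility of the syllepsis with `br X (Y ⊠ Z)`, one side. -/
def syllRightRoute₁ (X Y Z : B) :
    as X Y Z ≅ (br X Y ⊠ʳ Z ≫ as Y X Z ≫ Y ⊠ˡ br X Z) ≫ Y ⊠ˡ br Z X ≫ as' Y X Z ≫
      br Y X ⊠ʳ Z ≫ as X Y Z :=
  Iso.refl _ ≪⊗≫
    as X Y Z ◁ᵢ syll X (Y ⊠ Z) ≪⊗≫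
    (as X Y Z ≫ br X (Y ⊠ Z)) ◁ᵢ (hex₂ Y Z X).symm ≪⊗≫
    (hex₁ X Y Z).symm ▷ᵢ (Y ⊠ˡ br Z X ≫ as' Y X Z ≫ br Y X ⊠ʳ Z ≫ as X Y Z)

/-- Compatibility of the syllepsis with `br X (Y ⊠ Z)`, the other side. -/
def syllRightRoute₂ (X Y Z : B) :
    as X Y Z ≅ (br X Y ⊠ʳ Z ≫ as Y X Z ≫ Y ⊠ˡ br X Z) ≫ Y ⊠ˡ br Z X ≫ as' Y X Z ≫
      br Y X ⊠ʳ Z ≫ as X Y Z :=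
  Iso.refl _ ≪⊗≫
    ((tId _ _).symm ≪≫ tRIso (syll X Y) Z ≪≫ (tRComp _ _ Z).symm) ▷ᵢ as X Y Z ≪⊗≫
    (br X Y ⊠ʳ Z) ◁ᵢ asUnit Y X Z ▷ᵢ (br Y X ⊠ʳ Z ≫ as X Y Z) ≪⊗≫
    (br X Y ⊠ʳ Z ≫ as Y X Z) ◁ᵢ
      ((tId _ _).symm ≪≫ tLIso Y (syll X Z) ≪≫ (tLComp Y _ _).symm) ▷ᵢ
        (as' Y X Z ≫ br Y X ⊠ʳ Z ≫ as X Y Z) ≪⊗≫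
    Iso.refl _

/-- Compatibility of the syllepsis with `br (X ⊠ Y) Z`, one side. -/
def syllLeftRoute₁ (X Y Z : B) :
    as X Y Z ≅ (as X Y Z ≫ X ⊠ˡ br Y Z ≫ as' X Z Y ≫ br X Z ⊠ʳ Y) ≫ br Z X ⊠ʳ Y ≫
      as X Z Y ≫ X ⊠ˡ br Z Y :=
  Iso.refl _ ≪⊗≫
    syll (X ⊠ Y) Z ▷ᵢ as X Y Z ≪⊗≫
    (hex₂ X Y Z).symm ▷ᵢ (br Z (X ⊠ Y) ≫ as X Y Z) ≪⊗≫
    (as X Y Z ≫ X ⊠ˡ br Y Z ≫ as' X Z Y ≫ br X Z ⊠ʳ Y) ◁ᵢ (hex₁ Z X Y).symm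

/-- Compatibility of the syllepsis with `br (X ⊠ Y) Z`, the other side. -/
def syllLeftRoute₂ (X Y Z : B) :
    as X Y Z ≅ (as X Y Z ≫ X ⊠ˡ br Y Z ≫ as' X Z Y ≫ br X Z ⊠ʳ Y) ≫ br Z X ⊠ʳ Y ≫
      as X Z Y ≫ X ⊠ˡ br Z Y :=
  Iso.refl _ ≪⊗≫
    as X Y Z ◁ᵢ ((tId _ _).symm ≪≫ tLIso X (syll Y Z) ≪≫ (tLComp X _ _).symm) ≪⊗≫
    (as X Y Z ≫ X ⊠ˡ br Y Z) ◁ᵢ (asCounit X Z Y).symm ▷ᵢ (X ⊠ˡ br Z Y) ≪⊗≫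
    (as X Y Z ≫ X ⊠ˡ br Y Z ≫ as' X Z Y) ◁ᵢ
      ((tId _ _).symm ≪≫ tRIso (syll X Z) Y ≪≫ (tRComp _ _ Y).symm) ▷ᵢ
        (as X Z Y ≫ X ⊠ˡ br Z Y) ≪⊗≫
    Iso.refl _

end

/-- Symmetric monoidal bicategories, in fully weak form. -/
class SymmetricMonoidalBicategory (B : Type u) [Bicategory.{w, v} B] extends
    HexagonBicategory B where
  shuffle₁₃ (X Y Z T : B) : shuffle₁₃Route₁ X Y Z T = shuffle₁₃Route₂ X Y Z T
  shuffle₃₁ (X Y Z T : B) : shuffle₃₁Route₁ X Y Z T = shuffle₃₁Route₂ X Y Z T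
  shuffle₂₂ (X Y Z T : B) : shuffle₂₂Route₁ X Y Z T = shuffle₂₂Route₂ X Y Z T
  breen (X Y Z : B) : breenRoute₁ X Y Z = breenRoute₂ X Y Z
  syll_right (X Y Z : B) : syllRightRoute₁ X Y Z = syllRightRoute₂ X Y Z
  syll_left (X Y Z : B) : syllLeftRoute₁ X Y Z = syllLeftRoute₂ X Y Z
  symmetry (X Y : B) :
    (λ_ (br X Y)).symm ≪≫ whiskerRightIso (syll X Y) (br X Y) ≪≫ α_ _ _ _ =
      (ρ_ (br X Y)).symm ≪≫ whiskerLeftIso (br X Y) (syll Y X)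

end Symmetric

section Dagger

open TensorBicategory AssocUnitBicategory PentagonBicategory BraidingBicategory HexagonBicategory

/-- Symmetric monoidal bicategories with a reversal operation on 2-cells: an involution which is
the identity on objects and 1-cells, is contravariant for vertical composition, and preserves
horizontal composition, the tensor product and all structural 2-cells (every structural
isomorphism `σ` is unitary: its reversal is its inverse). -/
class SymmetricMonoidalDaggerBicategory (B : Type u) [Bicategory.{w, v} B] extends
    SymmetricMonoidalBicategory B where
  dag {X Y : B} {f g : X ⟶ Y} (η : f ⟶ g) : g ⟶ f
  dag_id {X Y : B} (f : X ⟶ Y) : dag (𝟙 f) = 𝟙 f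
  dag_comp {X Y : B} {f g h : X ⟶ Y} (η : f ⟶ g) (θ : g ⟶ h) : dag (η ≫ θ) = dag θ ≫ dag η
  dag_dag {X Y : B} {f g : X ⟶ Y} (η : f ⟶ g) : dag (dag η) = η
  dag_whiskerLeft {X Y Z : B} (f : X ⟶ Y) {g h : Y ⟶ Z} (η : g ⟶ h) :
    dag (f ◁ η) = f ◁ dag η
  dag_whiskerRight {X Y Z : B} {f g : X ⟶ Y} (η : f ⟶ g) (h : Y ⟶ Z) :
    dag (η ▷ h) = dag η ▷ h
  dag_associator {X Y Z T : B} (f : X ⟶ Y) (g : Y ⟶ Z) (h : Z ⟶ T) :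
    dag (α_ f g h).hom = (α_ f g h).inv
  dag_leftUnitor {X Y : B} (f : X ⟶ Y) : dag (λ_ f).hom = (λ_ f).inv
  dag_rightUnitor {X Y : B} (f : X ⟶ Y) : dag (ρ_ f).hom = (ρ_ f).inv
  dag_tensor {X Y : B × B} {f g : X ⟶ Y} (η : f ⟶ g) :
    dag (tensor.map₂ η) =
      tensor.map₂ (a := X) (b := Y) (f := g) (g := f) (dag η.1, dag η.2)
  dag_tensor_mapId (X : B × B) :
    dag (tensor.mapId X).hom = (tensor.mapId X).inv
  dag_tensor_mapComp {X Y Z : B × B} (f : X ⟶ Y) (g : Y ⟶ Z) :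
    dag (tensor.mapComp f g).hom = (tensor.mapComp f g).inv
  dag_assoc_nat {X Y : (B × B) × B} (f : X ⟶ Y) :
    dag (assocT.naturality f).hom = (assocT.naturality f).inv
  dag_assoc_unit (X : (B × B) × B) :
    dag (assocT.unit X).hom = (assocT.unit X).inv
  dag_assoc_counit (X : (B × B) × B) :
    dag (assocT.counit X).hom = (assocT.counit X).inv
  dag_left_nat {X Y : B} (f : X ⟶ Y) :
    dag (leftT.naturality f).hom = (leftT.naturality f).inv
  dag_left_unit (X : B) : dag (leftT.unit X).hom = (leftT.unit X).inv
  dag_left_counit (X : B) :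
    dag (leftT.counit X).hom = (leftT.counit X).inv
  dag_right_nat {X Y : B} (f : X ⟶ Y) :
    dag (rightT.naturality f).hom = (rightT.naturality f).inv
  dag_right_unit (X : B) : dag (rightT.unit X).hom = (rightT.unit X).inv
  dag_right_counit (X : B) :
    dag (rightT.counit X).hom = (rightT.counit X).inv
  dag_pent (X Y Z T : B) : dag (pent X Y Z T).hom = (pent X Y Z T).inv
  dag_unitMid (X Y : B) : dag (unitMid X Y).hom = (unitMid X Y).inv
  dag_unitLeft (X Y : B) : dag (unitLeft X Y).hom = (unitLeft X Y).inv
  dag_unitRight (X Y : B) : dag (unitRight X Y).hom = (unitRight X Y).inv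
  dag_braid_nat {X Y : B × B} (f : X ⟶ Y) :
    dag (braidT.naturality f).hom = (braidT.naturality f).inv
  dag_braid_unit (X : B × B) :
    dag (braidT.unit X).hom = (braidT.unit X).inv
  dag_braid_counit (X : B × B) :
    dag (braidT.counit X).hom = (braidT.counit X).inv
  dag_hex₁ (X Y Z : B) : dag (hex₁ X Y Z).hom = (hex₁ X Y Z).inv
  dag_hex₂ (X Y Z : B) : dag (hex₂ X Y Z).hom = (hex₂ X Y Z).inv
  dag_syll (X Y : B) : dag (syll X Y).hom = (syll X Y).inv

end Dagger

section Scalars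

/-! The scalars of a monoidal bicategory: the endo-1-cells of the unit object. Their tensor
product is composition of 1-cells. -/

open TensorBicategory PentagonBicategory

variable {B : Type u} [Bicategory.{w, v} B]

section

variable [MonoidalBicategory B]

local infixr:85 " ⊠ " => tObj
local infixr:85 " ⊠₁ " => tHom
local infixr:85 " ⊠ˡ " => tL
local infixl:85 " ⊠ʳ " => tR

/-- The coherence isomorphism between the left unitor and the right unitor tensored with `I`,
as 1-cells `(I ⊠ I) ⊠ I ⟶ I ⊠ I`. -/
def unitorsIsoAux : lu (I : B) ⊠ʳ (I : B) ≅ ru (I : B) ⊠ʳ (I : B) :=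
  unitLeft (I : B) I ≪⊗≫
    (as (I : B) I I ≫ lu ((I : B) ⊠ I)) ◁ᵢ luUnit (I : B) ≪⊗≫
    as (I : B) I I ◁ᵢ (luNat (lu (I : B))).symm ▷ᵢ lu' (I : B) ≪⊗≫
    (as (I : B) I I ≫ (I : B) ⊠ˡ lu (I : B)) ◁ᵢ (luUnit (I : B)).symm ≪⊗≫
    unitMid (I : B) I

/-- The coherence isomorphism between the two unitors `I ⊠ I ⟶ I`. -/
def unitorsIso : lu (I : B) ≅ ru (I : B) :=
  Iso.refl _ ≪⊗≫
    (ruCounit ((I : B) ⊠ I)).symm ▷ᵢ lu (I : B) ≪⊗≫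
    ru' ((I : B) ⊠ I) ◁ᵢ (ruNat (lu (I : B))).symm ≪⊗≫
    ru' ((I : B) ⊠ I) ◁ᵢ unitorsIsoAux ▷ᵢ ru (I : B) ≪⊗≫
    ru' ((I : B) ⊠ I) ◁ᵢ ruNat (ru (I : B)) ≪⊗≫
    ruCounit ((I : B) ⊠ I) ▷ᵢ ru (I : B) ≪⊗≫
    Iso.refl _

/-- The tensor product of two scalars is isomorphic to their composite, via the unitors. -/
def tensorScalarIso (f g : (I : B) ⟶ I) : f ⊠₁ g ≫ lu (I : B) ≅ ru (I : B) ≫ f ≫ g :=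
  Iso.refl _ ≪⊗≫
    tSplit f g ▷ᵢ lu (I : B) ≪⊗≫
    (f ⊠ʳ (I : B)) ◁ᵢ luNat g ≪⊗≫
    (f ⊠ʳ (I : B)) ◁ᵢ unitorsIso ▷ᵢ g ≪⊗≫
    ruNat f ▷ᵢ g ≪⊗≫
    Iso.refl _

/-- The tensor product of two scalars is isomorphic to their composite in the other order. -/
def tensorScalarIso' (f g : (I : B) ⟶ I) : f ⊠₁ g ≫ lu (I : B) ≅ ru (I : B) ≫ g ≫ f :=
  Iso.refl _ ≪⊗≫
    tSplit' f g ▷ᵢ lu (I : B) ≪⊗≫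
    ((I : B) ⊠ˡ g ≫ f ⊠ʳ (I : B)) ◁ᵢ unitorsIso ≪⊗≫
    ((I : B) ⊠ˡ g) ◁ᵢ ruNat f ≪⊗≫
    ((I : B) ⊠ˡ g) ◁ᵢ unitorsIso.symm ▷ᵢ f ≪⊗≫
    luNat g ▷ᵢ f ≪⊗≫
    unitorsIso ▷ᵢ (g ≫ f) ≪⊗≫
    Iso.refl _

/-- The crossing of two scalars, i.e. the symmetry of the monoidal category of scalars: both
composites `f ≫ g` and `g ≫ f` are identified with the tensor product `f ⊠ g`. -/
def scalarSwap (f g : (I : B) ⟶ I) : f ≫ g ≅ g ≫ f :=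
  Iso.refl _ ≪⊗≫
    (ruCounit (I : B)).symm ▷ᵢ (f ≫ g) ≪⊗≫
    ru' (I : B) ◁ᵢ ((tensorScalarIso f g).symm ≪≫ tensorScalarIso' f g) ≪⊗≫
    ruCounit (I : B) ▷ᵢ (g ≫ f) ≪⊗≫
    Iso.refl _

end

variable [SymmetricMonoidalDaggerBicategory B]

open SymmetricMonoidalDaggerBicategory

/-- `S` with multiplication `m` and unit `e` is a commutative dagger Frobenius algebra in the
symmetric monoidal dagger category of scalars. The comultiplication and the counit are the
reversals of `m` and `e`. -/
structure IsCommDaggerFrobenius {S : (I : B) ⟶ I} (m : S ≫ S ⟶ S) (e : 𝟙 I ⟶ S) : Prop where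
  assoc : m ▷ S ≫ m = (α_ S S S).hom ≫ S ◁ m ≫ m
  one_mul : e ▷ S ≫ m = (λ_ S).hom
  mul_one : S ◁ e ≫ m = (ρ_ S).hom
  comm : (scalarSwap S S).hom ≫ m = m
  frobenius_left : dag m ▷ S ≫ (α_ S S S).hom ≫ S ◁ m = m ≫ dag m
  frobenius_right : S ◁ dag m ≫ (α_ S S S).inv ≫ m ▷ S = m ≫ dag m

/-- `a` is a (right) action making `T` a module for the algebra `S` with multiplication `m` and
unit `e`, in the monoidal category of scalars. -/
structure IsModule {S T : (I : B) ⟶ I} (m : S ≫ S ⟶ S) (e : 𝟙 I ⟶ S) (a : T ≫ S ⟶ T) :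
    Prop where
  act_act : a ▷ S ≫ a = (α_ T S S).hom ≫ T ◁ m ≫ a
  act_one : T ◁ e ≫ a = (ρ_ T).hom

end Scalars

section Witness

open TensorBicategory SymmetricMonoidalDaggerBicategory

variable {B : Type u} [Bicategory.{w, v} B] [SymmetricMonoidalDaggerBicategory B]

/-- The multiplication on the composite `I ⟶ A ⟶ I` induced by a comparison 2-cell. -/
def inducedMul {A : B} {i : I ⟶ A} {o : A ⟶ I} (c : o ≫ i ⟶ 𝟙 A) :
    (i ≫ o) ≫ (i ≫ o) ⟶ i ≫ o :=
  𝟙 _ ⊗≫ i ◁ c ▷ o ⊗≫ 𝟙 _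

/-- Witnesses for an object `A`: 1-cells `A ⟶ I` and `I ⟶ A` with 2-cells which create, delete,
copy and compare classical data, deletion being the reversal of creation and copying the reversal
of comparison, such that the 1-cells are ambidextrous duals, copying followed by comparison is the
identity, and comparison is commutative. -/
structure Witness (A : B) where
  out : A ⟶ I
  inn : I ⟶ A
  create : 𝟙 I ⟶ inn ≫ out
  delete : inn ≫ out ⟶ 𝟙 I
  copy : 𝟙 A ⟶ out ≫ inn
  compare : out ≫ inn ⟶ 𝟙 A
  delete_eq : delete = dag create
  copy_eq : copy = dag compare
  yank₁ : (ρ_ out).inv ≫ out ◁ create ≫ (α_ _ _ _).inv ≫ compare ▷ out ≫ (λ_ out).hom = 𝟙 out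
  yank₂ : (λ_ out).inv ≫ copy ▷ out ≫ (α_ _ _ _).hom ≫ out ◁ delete ≫ (ρ_ out).hom = 𝟙 out
  yank₃ : (λ_ inn).inv ≫ create ▷ inn ≫ (α_ _ _ _).hom ≫ inn ◁ compare ≫ (ρ_ inn).hom = 𝟙 inn
  yank₄ : (ρ_ inn).inv ≫ inn ◁ copy ≫ (α_ _ _ _).inv ≫ delete ▷ inn ≫ (λ_ inn).hom = 𝟙 inn
  copy_compare : copy ≫ compare = 𝟙 (𝟙 A)
  swap_compare :
    (scalarSwap (inn ≫ out) (inn ≫ out)).hom ≫ inducedMul compare = inducedMul compare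

namespace Witness

variable {A : B} (W : Witness A)

/-- The witnessing system, shorn of its interaction with `A`. -/
def system : (I : B) ⟶ I := W.inn ≫ W.out

/-- The multiplication of the algebra arising from a witness. -/
def mul : W.system ≫ W.system ⟶ W.system := inducedMul W.compare

/-- The unit of the algebra arising from a witness. -/
def one : 𝟙 I ⟶ W.system := W.create

end Witness

/-- A projective measurement of the system `T`: a unitary 2-cell from `T` to a composite
`I ⟶ A ⟶ I` whose second factor is the witness. -/
structure ProjectiveMeasurement {A : B} (W : Witness A) (T : (I : B) ⟶ I) where
  post : I ⟶ A
  meas : T ⟶ post ≫ W.out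
  isometry : meas ≫ dag meas = 𝟙 T
  coisometry : dag meas ≫ meas = 𝟙 (post ≫ W.out)

/-- The action 2-cell of a projective measurement: measure, compare the outcome with the given
data, and undo the measurement. -/
def ProjectiveMeasurement.action {A : B} {W : Witness A} {T : (I : B) ⟶ I}
    (M : ProjectiveMeasurement W T) : T ≫ W.system ⟶ T :=
  M.meas ▷ (W.inn ≫ W.out) ⊗≫ M.post ◁ W.compare ▷ W.out ⊗≫ dag M.meas

end Witness

end HQ

/-! The multiplication and the action come from one construction. Given 1-cells `o : A ⟶ X` and `i :
X ⟶ A` and a 2-cell `c : o ≫ i ⟶ 𝟙 A`, any `p : Y ⟶ A` yields a 2-cell `(p ≫ o) ≫ (i ≫ o) ⟶ p ≫ o`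
that contracts the inner `o ≫ i`; this is `compareAction c p`. Taking `p = i` gives the
multiplication `m` on `S = i ≫ o`, and taking `p` to be the post-measurement 1-cell gives the action
of `S` on the measured system `p ≫ o`. A law proved for all `p` therefore serves both halves of the
theorem.

The associative law (`compareAction_assoc`) is interchange: on `p ≫ o ≫ i ≫ o ≫ i ≫ o` the two
contractions use disjoint pairs `o ≫ i`, so their order is irrelevant. The unit laws
(`compareAction_unit`, `unit_compareAction`) are the zigzag equations of the duality, whiskered by a
1-cell. Reversal is compatible with whiskering and coherence, so the reversal of `m` inserts `dag c`
where `m` contracts with `c` (`dag_compareAction`); the Frobenius equations then say that an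
insertion and a contraction at different places commute, which is interchange again. Commutativity
is part of the data of a witness.

The module `T` is not `p ≫ o` itself but is unitarily isomorphic to it through the measurement. The
module laws are moved across this isomorphism: `μ† ≫ μ = 𝟙` gives compatibility with multiplication,
and `μ ≫ μ† = 𝟙` gives the unit law (`transport_act_act`, `transport_act_one`). -/

namespace HQ

open CategoryTheory Bicategory TensorBicategory SymmetricMonoidalDaggerBicategory

/-! ### Contraction and insertion 2-cells in a bare bicategory. -/

section Comparison

variable {B : Type u} [Bicategory.{w, v} B] {X A : B} {i : X ⟶ A} {o : A ⟶ X}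

/-- The action on `p ≫ o` of the composite `i ≫ o` induced by a comparison 2-cell. -/
def compareAction (c : o ≫ i ⟶ 𝟙 A) {Y : B} (p : Y ⟶ A) : (p ≫ o) ≫ (i ≫ o) ⟶ p ≫ o :=
  𝟙 _ ⊗≫ p ◁ c ▷ o ⊗≫ 𝟙 _

/-- The coaction on `p ≫ o` of the composite `i ≫ o` induced by a copying 2-cell. -/
def copyCoaction (d : 𝟙 A ⟶ o ≫ i) {Y : B} (p : Y ⟶ A) : p ≫ o ⟶ (p ≫ o) ≫ (i ≫ o) :=
  𝟙 _ ⊗≫ p ◁ d ▷ o ⊗≫ 𝟙 _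

/-- Interchange of two independent copies of `c`. Keeping `p` arbitrary makes this both
associativity of `m` (at `p = i`) and the module law on a measured system. -/
theorem compareAction_assoc (c : o ≫ i ⟶ 𝟙 A) {Y : B} (p : Y ⟶ A) :
    compareAction c p ▷ (i ≫ o) ≫ compareAction c p =
      (α_ _ _ _).hom ≫ (p ≫ o) ◁ compareAction c i ≫ compareAction c p := by
  unfold compareAction
  calc
    -- Coherence strips off the outer `p` and `o`; what remains is a statement about 2-cells from
    -- `(o ≫ i) ≫ (o ≫ i)` to the identity of `A`.
    _ = 𝟙 _ ⊗≫ p ◁ (c ▷ (o ≫ i) ≫ 𝟙 A ◁ c) ▷ o ⊗≫ 𝟙 _ := by bicategory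
    _ = 𝟙 _ ⊗≫ p ◁ ((o ≫ i) ◁ c ≫ c ▷ 𝟙 A) ▷ o ⊗≫ 𝟙 _ := by rw [whisker_exchange]
    _ = _ := by bicategory

/-- The unit is created to the right of `o` and its `i` is contracted with that `o`, so the
composite is the zigzag for `o` whiskered on the left by `p`. It supplies the right unit law of `S`
and the unit law of the module. -/
theorem compareAction_unit (c : o ≫ i ⟶ 𝟙 A) (e : 𝟙 X ⟶ i ≫ o)
    (h : (ρ_ o).inv ≫ o ◁ e ≫ (α_ _ _ _).inv ≫ c ▷ o ≫ (λ_ o).hom = 𝟙 o)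
    {Y : B} (p : Y ⟶ A) :
    (p ≫ o) ◁ e ≫ compareAction c p = (ρ_ (p ≫ o)).hom := by
  unfold compareAction
  calc
    _ = 𝟙 _ ⊗≫ p ◁ ((ρ_ o).inv ≫ o ◁ e ≫ (α_ _ _ _).inv ≫ c ▷ o ≫ (λ_ o).hom) ⊗≫ 𝟙 _ := by
      bicategory
    _ = _ := by
      rw [h]
      bicategory

/-- Here the other zigzag, the one for `i`, appears, whiskered on the right by `o`. The unit is
created in front of the first `i`, so the case `p = i` is needed. -/
theorem unit_compareAction (c : o ≫ i ⟶ 𝟙 A) (e : 𝟙 X ⟶ i ≫ o)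
    (h : (λ_ i).inv ≫ e ▷ i ≫ (α_ _ _ _).hom ≫ i ◁ c ≫ (ρ_ i).hom = 𝟙 i) :
    e ▷ (i ≫ o) ≫ compareAction c i = (λ_ (i ≫ o)).hom := by
  unfold compareAction
  calc
    _ = 𝟙 _ ⊗≫ ((λ_ i).inv ≫ e ▷ i ≫ (α_ _ _ _).hom ≫ i ◁ c ≫ (ρ_ i).hom) ▷ o ⊗≫ 𝟙 _ := by
      bicategory
    _ = _ := by
      rw [h]
      bicategory

/-- Between the outer `i` and `o`, `d` inserts a pair to the left of the pair that `c` contracts.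
The two do not overlap, so interchange lets the contraction happen first, for any `c` and `d`. -/
theorem copyCoaction_compareAction_left (c : o ≫ i ⟶ 𝟙 A) (d : 𝟙 A ⟶ o ≫ i) :
    copyCoaction d i ▷ (i ≫ o) ≫ (α_ _ _ _).hom ≫ (i ≫ o) ◁ compareAction c i =
      compareAction c i ≫ copyCoaction d i := by
  unfold compareAction copyCoaction
  calc
    _ = 𝟙 _ ⊗≫ i ◁ (d ▷ (o ≫ i) ≫ (o ≫ i) ◁ c) ▷ o ⊗≫ 𝟙 _ := by bicategory
    _ = 𝟙 _ ⊗≫ i ◁ (𝟙 A ◁ c ≫ d ▷ 𝟙 A) ▷ o ⊗≫ 𝟙 _ := by rw [whisker_exchange]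
    _ = _ := by bicategory

/-- Mirror image of the previous argument: the insertion is now to the right of the contracted pair.
-/
theorem copyCoaction_compareAction_right (c : o ≫ i ⟶ 𝟙 A) (d : 𝟙 A ⟶ o ≫ i) :
    (i ≫ o) ◁ copyCoaction d i ≫ (α_ _ _ _).inv ≫ compareAction c i ▷ (i ≫ o) =
      compareAction c i ≫ copyCoaction d i := by
  unfold compareAction copyCoaction
  calc
    _ = 𝟙 _ ⊗≫ i ◁ ((o ≫ i) ◁ d ≫ c ▷ (o ≫ i)) ▷ o ⊗≫ 𝟙 _ := by bicategory
    _ = 𝟙 _ ⊗≫ i ◁ (c ▷ 𝟙 A ≫ 𝟙 A ◁ d) ▷ o ⊗≫ 𝟙 _ := by rw [whisker_exchange]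
    _ = _ := by bicategory

/-- Transport of an action along `t : T ⟶ P` with retraction `t'`. -/
theorem transport_act_act {Y : B} {T P : Y ⟶ X} {S : X ⟶ X} (m : S ≫ S ⟶ S) (a : P ≫ S ⟶ P)
    (t : T ⟶ P) (t' : P ⟶ T) (ht : t' ≫ t = 𝟙 P)
    (ha : a ▷ S ≫ a = (α_ P S S).hom ≫ P ◁ m ≫ a) :
    (t ▷ S ≫ a ≫ t') ▷ S ≫ t ▷ S ≫ a ≫ t' =
      (α_ T S S).hom ≫ T ◁ m ≫ t ▷ S ≫ a ≫ t' := by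
  calc
    -- Between the two actions the element is carried back to `T` and at once to `P` again; this
    -- round trip is what `ht` cancels.
    _ = t ▷ S ▷ S ≫ a ▷ S ≫ (t' ≫ t) ▷ S ≫ a ≫ t' := by simp
    _ = t ▷ S ▷ S ≫ (a ▷ S ≫ a) ≫ t' := by simp [ht]
    _ = (α_ T S S).hom ≫ (t ▷ (S ≫ S) ≫ P ◁ m) ≫ a ≫ t' := by simp [ha]
    _ = _ := by
      -- `t` acts on the module factor and `m` on the algebra factors, so they commute.
      rw [← whisker_exchange]
      simp

/-- Once `e` is moved past `t`, the unit law on `P` collapses the action and leaves the round trip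
from `T` through `P`. Thus `t'` must be a left inverse in the sense `t ≫ t' = 𝟙 T`, the opposite
order to the one in `transport_act_act`. -/
theorem transport_act_one {Y : B} {T P : Y ⟶ X} {S : X ⟶ X} (e : 𝟙 X ⟶ S) (a : P ≫ S ⟶ P)
    (t : T ⟶ P) (t' : P ⟶ T) (ht : t ≫ t' = 𝟙 T) (ha : P ◁ e ≫ a = (ρ_ P).hom) :
    T ◁ e ≫ t ▷ S ≫ a ≫ t' = (ρ_ T).hom := by
  rw [whisker_exchange_assoc, reassoc_of% ha]
  simp [ht]

end Comparison

/-! ### Reversal of the contraction. -/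

section Dagger

variable {B : Type u} [Bicategory.{w, v} B] [SymmetricMonoidalDaggerBicategory B]

/-- Reversal respects whiskering and inverts the structural 2-cells, so only `c` changes in
substance. At `p = i` this identifies the comultiplication. -/
theorem dag_compareAction {X A : B} {i : X ⟶ A} {o : A ⟶ X} (c : o ≫ i ⟶ 𝟙 A) {Y : B}
    (p : Y ⟶ A) : dag (compareAction c p) = copyCoaction (dag c) p := by
  -- Unitarity is assumed for the forward associator; involutivity extends it to the inverse.
  have dag_associator_inv {X Y Z T : B} (f : X ⟶ Y) (g : Y ⟶ Z) (h : Z ⟶ T) :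
      dag (α_ f g h).inv = (α_ f g h).hom := by
    rw [← dag_associator, dag_dag]
  -- The coherence hidden in `⊗≫` is spelled out in associators and a left unitor, the generators on
  -- which the reversal is prescribed.
  have hc : compareAction c p =
      (α_ _ _ _).hom ≫ p ◁ ((α_ _ _ _).inv ≫ c ▷ o ≫ (λ_ o).hom) := by
    unfold compareAction
    bicategory
  rw [hc]
  simp only [dag_comp, dag_whiskerLeft, dag_whiskerRight, dag_associator, dag_associator_inv,
    dag_leftUnitor]
  unfold copyCoaction
  bicategory

end Dagger

/-- Up to coherence, the action is the contraction conjugated by the measurement, which is the shape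
the transport lemmas require. -/
theorem ProjectiveMeasurement.action_eq {B : Type u} [Bicategory.{w, v} B]
    [SymmetricMonoidalDaggerBicategory B] {A : B} {W : Witness A} {T : (I : B) ⟶ I}
    (M : ProjectiveMeasurement W T) :
    M.action = M.meas ▷ W.system ≫ compareAction W.compare M.post ≫ dag M.meas := by
  unfold ProjectiveMeasurement.action compareAction Witness.system
  bicategory

end HQ

/-! ### Assembly of the Frobenius algebra and its module. -/

theorem mainTheorem9 {B : Type u} [CategoryTheory.Bicategory.{w, v} B]
    [HQ.SymmetricMonoidalDaggerBicategory B] {A : B} (W : HQ.Witness A)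
    {T : (HQ.TensorBicategory.I : B) ⟶ HQ.TensorBicategory.I}
    (M : HQ.ProjectiveMeasurement W T) :
    HQ.IsCommDaggerFrobenius W.mul W.one ∧ HQ.IsModule W.mul W.one M.action := by
  -- This is definitional, so the general lemmas at `p = W.inn` apply to `W.mul` as they stand.
  have hm : W.mul = HQ.compareAction W.compare W.inn := rfl
  have hd : HQ.SymmetricMonoidalDaggerBicategory.dag W.mul =
      HQ.copyCoaction (HQ.SymmetricMonoidalDaggerBicategory.dag W.compare) W.inn :=
    HQ.dag_compareAction W.compare W.inn
  refine ⟨⟨HQ.compareAction_assoc _ _, HQ.unit_compareAction _ _ W.yank₃,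
    HQ.compareAction_unit _ _ W.yank₁ _, W.swap_compare, ?_, ?_⟩, ⟨?_, ?_⟩⟩
  · rw [hd]
    exact HQ.copyCoaction_compareAction_left _ _
  · rw [hd]
    exact HQ.copyCoaction_compareAction_right _ _
  · rw [M.action_eq]
    -- The associativity lemma is used here at `p = M.post`.
    exact HQ.transport_act_act _ _ _ _ M.coisometry (HQ.compareAction_assoc _ _)
  · rw [M.action_eq]
    exact HQ.transport_act_one _ _ _ _ M.isometry (HQ.compareAction_unit _ _ W.yank₁ _)
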